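/- **Setting.** All transfer functions are real rational functions of one complex variable $s$, $j$ is the imaginary unit, and poles are counted with multiplicity. A rational function $h$ is *exponentially stable* if all its poles lie in $\{\Re s<0\}$ and *exponentially unstable* if it has a pole in $\{\Re s>0\}$; a proper $h$ that is neither is *marginally stable* if each of its poles on the imaginary axis is simple. A *stable* $f$ is a proper, exponentially stable rational function, and $\|f\|_{H_\infty}=\sup_{\Re s>0}|f(s)|$. For $g$ bounded on the imaginary axis put $\|g\|_{L_\infty}=\sup_{\omega\in\mathbb R}|g(j\omega)|$. For $n\in\mathbb N$ let $\mathcal G_n$ be the set of strictly proper real rational functions $g$ which are bounded (without poles) on the imaginary axis, are not exponentially stable, have exactly $n$ unstable poles (poles with $\Re s\ge 0$), and satisfy the parity interlacing property: between any two real zeros of $g$ in the closed right half plane, the zero at $\infty$ included, the number of real poles of $g$ is even. Let $$\mathcal G_n^0=\{g\in\mathcal G_n:\ \|g\|_{L_\infty}=|g(0)|>|g(j\omega)|\ \ \forall\,\omega\ne 0\},$$ $$\mathcal G_n^{\#}=\{g\in\mathcal G_n:\ \exists\,\omega_p>0,\ \|g\|_{L_\infty}=|g(j\omega_p)|>|g(j\omega)|\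 \ \forall\,\omega\ne\pm\omega_p\}.$$ Let $\theta_g(\omega)$ be a continuous choice, near the peak frequency ($0$ or $\omega_p$), of the phase angle of $g(j\omega)$, and $\theta_g'$ its derivative with respect to $\omega$. A stable $f$ *marginally stabilizes* $g$ if the positive feedback system with loop transfer function $fg$ is internally marginally stable, i.e. there is no pole/zero cancellation between $f$ and $g$ in $\{\Re s\ge 0\}$ and $1/(1-fg)$ is marginally stable. **Theorem.** (I) Let $g\in\mathcal G_n^0$. There is a stable $f$ with $\|f\|_{H_\infty}=1/\|g\|_{L_\infty}=1/|g(0)|$ that marginally stabilizes $g$ if and only if $$n=1\quad\text{and}\quad \theta_g'(0)>0 .$$ In that case $f$ can be taken to be a real constant. (II) Let $g\in\mathcal G_n^{\#}$ with peak frequency $\omega_p>0$. There is a stable $f$ with $\|f\|_{H_\infty}=1/\|g\|_{L_\infty}=1/|g(j\omega_p)|$ that marginally stabilizes $g$ if and only if $$n=2\quad\text{and}\quad \theta_g'(\omega_p)>\left|\frac{\sin\theta_g(\omega_p)}{\omega_p}\right| .$$ In that case $f$ can be taken to be a real constant if $\sin\theta_g(\omega_p)=0$, and a first-order all-pass function $f(s)=k\,\frac{a-s}{a+s}$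 with $a>0$, $k\in\mathbb R\setminus\{0\}$, if $\sin\theta_g(\omega_p)\neq 0$. -/

import Mathlib

open Filter Topology

/-! Real rational transfer functions are elements `h` of `RatFunc ℝ`; `h.num` and `h.denom` are the
coprime numerator and (monic) denominator. -/

noncomputable section

namespace TransferFunction

/-- The value `h(s)` at a complex point `s` (meaningful when `s` is not a pole of `h`). -/
def value (h : RatFunc ℝ) (s : ℂ) : ℂ := h.eval (algebraMap ℝ ℂ) s

/-- The frequency response `ω ↦ h(jω)`. -/
def freqResp (h : RatFunc ℝ) (ω : ℝ) : ℂ := value h (Complex.I * (ω : ℂ))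

/-- `s` is a pole of `h`. -/
def IsPole (h : RatFunc ℝ) (s : ℂ) : Prop := Polynomial.aeval s h.denom = 0

/-- `s` is a (finite) zero of `h`. -/
def IsZeroAt (h : RatFunc ℝ) (s : ℂ) : Prop := Polynomial.aeval s h.num = 0

/-- The multiplicity of `s` as a pole of `h` (zero if `s` is not a pole). -/
def poleOrder (h : RatFunc ℝ) (s : ℂ) : ℕ :=
  (h.denom.map (algebraMap ℝ ℂ)).rootMultiplicity s

def IsProper (h : RatFunc ℝ) : Prop := h.num.degree ≤ h.denom.degree

def IsStrictlyProper (h : RatFunc ℝ) : Prop := h.num.degree < h.denom.degree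

/-- All poles lie in the open left half plane. -/
def ExponentiallyStable (h : RatFunc ℝ) : Prop := ∀ s : ℂ, IsPole h s → s.re < 0

/-- At least one pole lies in the open right half plane. -/
def ExponentiallyUnstable (h : RatFunc ℝ) : Prop := ∃ s : ℂ, IsPole h s ∧ 0 < s.re

/-- A proper `h` which is neither exponentially stable nor exponentially unstable is marginally
stable if all its poles on the imaginary axis are simple. -/
def MarginallyStable (h : RatFunc ℝ) : Prop :=
  IsProper h ∧ ¬ ExponentiallyStable h ∧ ¬ ExponentiallyUnstable h ∧
    ∀ s : ℂ, IsPole h s → s.re = 0 → poleOrder h s = 1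

/-- `h` has no pole on the imaginary axis and is bounded there. -/
def IsRLInf (h : RatFunc ℝ) : Prop :=
  (∀ ω : ℝ, ¬ IsPole h (Complex.I * (ω : ℂ))) ∧ ∃ M : ℝ, ∀ ω : ℝ, ‖freqResp h ω‖ ≤ M

/-- Proper stable real rational functions. -/
def IsRHInf (f : RatFunc ℝ) : Prop := IsProper f ∧ ExponentiallyStable f

/-- `sup_ω |h(jω)|`. -/
def lInfNorm (h : RatFunc ℝ) : ℝ := ⨆ ω : ℝ, ‖freqResp h ω‖

/-- `sup_{Re s > 0} |f(s)|`. -/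
def hInfNorm (f : RatFunc ℝ) : ℝ := ⨆ s : {s : ℂ // 0 < s.re}, ‖value f s.1‖

/-- The number of unstable poles, counted with multiplicity. -/
def numUnstablePoles (g : RatFunc ℝ) : ℕ :=
  Multiset.card ((g.denom.aroots ℂ).filter (fun s => 0 ≤ s.re))

/-- Parity interlacing property of a strictly proper `g` (so that `∞` is a zero of `g`): between any
two real zeros of `g` in the closed right half plane, `∞` included, the number of real poles of
`g`, counted with multiplicity, is even. -/
def ParityInterlacing (g : RatFunc ℝ) : Prop :=
  (∀ z : ℝ, 0 ≤ z → IsZeroAt g (z : ℂ) →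
    Even (Multiset.card (g.denom.roots.filter (fun x => z < x)))) ∧
  (∀ z w : ℝ, 0 ≤ z → z < w → IsZeroAt g (z : ℂ) → IsZeroAt g (w : ℂ) →
    Even (Multiset.card (g.denom.roots.filter (fun x => z < x ∧ x < w))))

/-- The strictly proper unstable functions in `RL_∞` with exactly `n` unstable poles that satisfy
the parity interlacing property. -/
structure ClassG (n : ℕ) (g : RatFunc ℝ) : Prop where
  isRLInf : IsRLInf g
  strictlyProper : IsStrictlyProper g
  unstable : ¬ ExponentiallyStable g
  numUnstablePoles_eq : numUnstablePoles g = n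
  parityInterlacing : ParityInterlacing g

/-- Members of `ClassG n` with the unique peak frequency `0`. -/
structure ClassGZero (n : ℕ) (g : RatFunc ℝ) : Prop extends ClassG n g where
  norm_eq : lInfNorm g = ‖freqResp g 0‖
  lt_peak : ∀ ω : ℝ, ω ≠ 0 → ‖freqResp g ω‖ < ‖freqResp g 0‖

/-- Members of `ClassG n` whose only peak frequencies are `±ωp`, where `ωp > 0`. -/
structure ClassGSharp (n : ℕ) (g : RatFunc ℝ) (ωp : ℝ) : Prop extends ClassG n g where
  pos : 0 < ωp
  norm_eq : lInfNorm g = ‖freqResp g ωp‖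
  lt_peak : ∀ ω : ℝ, ω ≠ ωp → ω ≠ -ωp → ‖freqResp g ω‖ < ‖freqResp g ωp‖

/-- `θ` is, near `ω₀`, a continuous choice of the phase angle of `g(jω)`. -/
def IsPhaseNear (g : RatFunc ℝ) (ω₀ : ℝ) (θ : ℝ → ℝ) : Prop :=
  ∀ᶠ ω in 𝓝 ω₀, ContinuousAt θ ω ∧
    freqResp g ω = (‖freqResp g ω‖ : ℂ) * Complex.exp ((θ ω : ℂ) * Complex.I)

/-- No pole of one factor in the closed right half plane is a zero of the other. -/
def NoUnstableCancellation (f g : RatFunc ℝ) : Prop :=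
  ∀ s : ℂ, 0 ≤ s.re → ¬ (IsZeroAt f s ∧ IsPole g s) ∧ ¬ (IsZeroAt g s ∧ IsPole f s)

/-- The positive feedback interconnection of `g` and `f`, with loop transfer function `f g`, is
(internally) marginally stable. -/
def MarginallyStabilizes (f g : RatFunc ℝ) : Prop :=
  NoUnstableCancellation f g ∧ MarginallyStable (1 / (1 - f * g))

/-- Stable first-order all-pass functions, i.e. `k (a - s) / (a + s)` with `a > 0`, `k ≠ 0`. -/
def IsFirstOrderAllPass (f : RatFunc ℝ) : Prop :=
  ∃ k a : ℝ, k ≠ 0 ∧ 0 < a ∧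
    f = RatFunc.C k * ((RatFunc.C a - RatFunc.X) / (RatFunc.C a + RatFunc.X))

lemma continuousAt_freqResp (g : RatFunc ℝ) (ω₀ : ℝ)
    (h : ¬ IsPole g (Complex.I * (ω₀ : ℂ))) : ContinuousAt (freqResp g) ω₀ := by
  have e : freqResp g = fun ω : ℝ => Polynomial.aeval (Complex.I * (ω : ℂ)) g.num /
      Polynomial.aeval (Complex.I * (ω : ℂ)) g.denom := rfl
  rw [e]
  refine ContinuousAt.div ?_ ?_ h
  · exact ((Polynomial.continuous_aeval g.num).comp (by fun_prop)).continuousAt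
  · exact ((Polynomial.continuous_aeval g.denom).comp (by fun_prop)).continuousAt

/-- A continuous phase exists near every frequency that is neither a pole nor a zero. -/
lemma exists_isPhaseNear (g : RatFunc ℝ) (ω₀ : ℝ) (hg : IsRLInf g) (h0 : freqResp g ω₀ ≠ 0) :
    ∃ θ : ℝ → ℝ, IsPhaseNear g ω₀ θ := by
  have hc : ∀ ω, ContinuousAt (freqResp g) ω := fun ω => continuousAt_freqResp g ω (hg.1 ω)
  refine ⟨fun ω => Complex.arg (freqResp g ω₀) + Complex.arg (freqResp g ω / freqResp g ω₀), ?_⟩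
  have hq : ∀ ω, ContinuousAt (fun ω => freqResp g ω / freqResp g ω₀) ω :=
    fun ω => (hc ω).div_const _
  have hs : ∀ᶠ ω in 𝓝 ω₀, freqResp g ω / freqResp g ω₀ ∈ Complex.slitPlane := by
    apply (hq ω₀).eventually_mem
    apply Complex.isOpen_slitPlane.mem_nhds
    rw [div_self h0]
    exact Complex.one_mem_slitPlane
  filter_upwards [hs] with ω hω
  refine ⟨continuousAt_const.add (ContinuousAt.comp
    (f := fun ω => freqResp g ω / freqResp g ω₀) (Complex.continuousAt_arg hω) (hq ω)), ?_⟩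
  have h1 := Complex.norm_mul_exp_arg_mul_I (freqResp g ω₀)
  have h2 := Complex.norm_mul_exp_arg_mul_I (freqResp g ω / freqResp g ω₀)
  have h3 : freqResp g ω = freqResp g ω₀ * (freqResp g ω / freqResp g ω₀) := by
    field_simp
  have h4 : (‖freqResp g ω‖ : ℂ) =
      (‖freqResp g ω₀‖ : ℂ) * (‖freqResp g ω / freqResp g ω₀‖ : ℂ) := by
    rw [← Complex.ofReal_mul, ← norm_mul, ← h3]
  calc freqResp g ω = freqResp g ω₀ * (freqResp g ω / freqResp g ω₀) := h3
    _ = (‖freqResp g ω₀‖ * Complex.exp (Complex.arg (freqResp g ω₀) * Complex.I)) *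
        (‖freqResp g ω / freqResp g ω₀‖ *
          Complex.exp (Complex.arg (freqResp g ω / freqResp g ω₀) * Complex.I)) := by
        rw [h1, h2]
    _ = _ := by
        rw [h4]
        push_cast
        rw [add_mul, Complex.exp_add]
        ring

end TransferFunction

end

open TransferFunction

/-!
Write `f = P / Q` and `g = N / D` in lowest terms, `A = Q D`, `B = P N` and `L = B / A = f g`. Without
unstable cancellations, the poles of `1 / (1 - f g)` in the closed right half plane are the roots of
`A - B` there, with multiplicity (`poleOrder_closedLoop`). Along the homotopy `A - t B`, `0 ≤ t < 1`,
the bound `|L| ≤ 1` on the imaginary axis prevents roots from crossing it, so exactly `n` roots stay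
in the open right half plane (`rhpCount_homotopy`). As the root vectors of monic polynomials of fixed
degree stay in a compact set, they converge along a sequence `t → 1` (`exists_tracked_roots`), and
marginal stability means that these `n` roots reach the axis at `t = 1`, at distinct points, since
multiple roots are forbidden, and at peak frequencies, since there `L = 1`.

A root `s` of `A - t B` satisfies `L s = 1 / t > 1`. Hence near a simple point `s₀` of the axis with
`L s₀ = 1`, where `L' s₀` is real because `|L|` is maximal, a root arrives from the right exactly if
`L' s₀ > 0`. This yields `exists_crossings` and its converse `simple_roots_of_crossings`. With the
single peak `0` there is room for one root only; with the peaks `±jωp` there is room for two, and one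
alone is impossible because the only unstable root of a real polynomial is real.

At a peak `L' = f' / f + g' / g`, and the real part of `g' / g` is the derivative of the phase of `g`
(`deriv_phase`). As `|f|` is bounded by its value at the peak, the Schwarz-Pick inequality for the
pair `z`, `conj z`, with `z` tending to the boundary, gives `Re (f' / f) ≤ -|sin θ| / ωp`
(`abs_sin_le_of_value_mul_eq_one`), and at frequency `0` simply `Re (f' / f) ≤ 0`. So `L' > 0` forces
the stated phase conditions. Constants have `f' = 0`, and the first-order all-pass function that
inverts `g` at `jωp` attains equality (`exists_allPass_parameters`, `logDeriv_allPass`); under the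
phase conditions they therefore produce the required crossings.
-/

noncomputable section

namespace TransferFunction

open Polynomial ComplexConjugate

/-! ### Roots of convergent sequences of polynomials -/

/-- The number of roots of `p` in the open right half plane, counted with multiplicity. -/
def rhpCount (p : ℂ[X]) : ℕ := Multiset.card (p.roots.filter (fun s => 0 < s.re))

lemma exists_eq_prod_X_sub_C {p : ℂ[X]} (hp : p.Monic) :
    ∃ r : Fin p.natDegree → ℂ, p = ∏ i, (X - C (r i)) := by
  have hs : p.Splits := IsAlgClosed.splits p
  have hc : p.roots.toList.length = p.natDegree := by
    rw [Multiset.length_toList, hs.natDegree_eq_card_roots]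
  refine ⟨fun i => p.roots.toList.get (i.cast hc.symm), ?_⟩
  have h1 : p = (p.roots.map (fun a => X - C a)).prod := by
    simpa [hp.leadingCoeff] using hs.eq_prod_roots
  have h2 : ∏ i : Fin p.natDegree, (X - C (p.roots.toList.get (i.cast hc.symm)))
      = ∏ i : Fin p.roots.toList.length, (X - C (p.roots.toList.get i)) :=
    Fintype.prod_equiv (finCongr hc.symm) _ _ (fun i => rfl)
  rw [h2]
  conv_lhs => rw [h1, ← Multiset.coe_toList p.roots]
  rw [Multiset.map_coe, Multiset.prod_coe, ← List.prod_ofFn]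
  congr 1
  apply List.ext_getElem <;> simp

lemma rhpCount_prod {m : ℕ} (r : Fin m → ℂ) :
    rhpCount (∏ i, (X - C (r i))) = (Finset.univ.filter (fun i => 0 < (r i).re)).card := by
  have : (∏ i, (X - C (r i))).roots = Finset.univ.val.map r := by
    have := roots_multiset_prod_X_sub_C (Finset.univ.val.map r)
    rwa [Multiset.map_map] at this
  rw [rhpCount, this, Multiset.filter_map, Multiset.card_map]
  rfl

/-- The roots of a pointwise convergent sequence of monic polynomials of fixed degree, if they stay
bounded, converge along a subsequence to the roots of the limit. -/
lemma exists_subseq_roots_tendsto {m : ℕ} {p : ℕ → ℂ[X]} {q : ℂ[X]} {R : ℝ}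
    (hp : ∀ k, (p k).Monic) (hd : ∀ k, (p k).natDegree = m)
    (hR : ∀ k z, (p k).IsRoot z → ‖z‖ ≤ R)
    (hlim : ∀ z, Tendsto (fun k => (p k).eval z) atTop (𝓝 (q.eval z))) :
    ∃ φ : ℕ → ℕ, StrictMono φ ∧ ∃ (r : ℕ → Fin m → ℂ) (r' : Fin m → ℂ),
      (∀ k, p (φ k) = ∏ i, (X - C (r k i))) ∧ q = ∏ i, (X - C (r' i)) ∧
        ∀ i, Tendsto (fun k => r k i) atTop (𝓝 (r' i)) := by
  have h1 : ∀ k, ∃ r : Fin m → ℂ, p k = ∏ i, (X - C (r i)) := fun k => by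
    have := exists_eq_prod_X_sub_C (hp k)
    rwa [hd k] at this
  choose r hr using h1
  have hb : ∀ k, r k ∈ Metric.closedBall (0 : Fin m → ℂ) |R| := fun k => by
    rw [mem_closedBall_zero_iff, pi_norm_le_iff_of_nonneg (abs_nonneg R)]
    intro i
    refine (hR k (r k i) ?_).trans (le_abs_self R)
    rw [hr k, IsRoot.def, eval_prod]
    exact Finset.prod_eq_zero (Finset.mem_univ i) (by simp)
  obtain ⟨r', -, φ, hφ, hlim'⟩ := tendsto_subseq_of_bounded Metric.isBounded_closedBall hb
  have hi := tendsto_pi_nhds.1 hlim'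
  refine ⟨φ, hφ, fun k => r (φ k), r', fun k => hr _, ?_, hi⟩
  refine Polynomial.funext fun z => ?_
  refine tendsto_nhds_unique ((hlim z).comp hφ.tendsto_atTop) ?_
  rw [eval_prod]
  have : ((fun k => (p k).eval z) ∘ φ) = fun k => ∏ i, (z - r (φ k) i) := by
    funext k
    simp only [Function.comp]
    rw [hr (φ k), eval_prod]
    simp
  rw [this]
  simp only [eval_sub, eval_X, eval_C]
  exact tendsto_finsetProd _ fun i _ => tendsto_const_nhds.sub (hi i)

/-! ### Roots along the homotopy `A - t * B` -/

section Homotopy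

variable {A B : ℂ[X]}

lemma degree_C_mul_lt (hdeg : B.degree < A.degree) (c : ℂ) : (C c * B).degree < A.degree := by
  rw [← smul_eq_C_mul]
  exact (degree_smul_le _ _).trans_lt hdeg

lemma monic_sub_C_mul (hA : A.Monic) (hdeg : B.degree < A.degree) (t : ℝ) :
    (A - C (t : ℂ) * B).Monic :=
  hA.sub_of_left (degree_C_mul_lt hdeg _)

lemma natDegree_sub_C_mul (hdeg : B.degree < A.degree) (t : ℝ) :
    (A - C (t : ℂ) * B).natDegree = A.natDegree :=
  natDegree_eq_of_degree_eq (degree_sub_eq_left_of_degree_lt (degree_C_mul_lt hdeg _))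

/-- Where `|B| < |A|`, which holds near infinity, no `A - t * B` with `t ≤ 1` vanishes. -/
lemma exists_root_bound (hdeg : B.degree < A.degree) :
    ∃ R : ℝ, ∀ t ∈ Set.Icc (0 : ℝ) 1, ∀ z, (A - C (t : ℂ) * B).IsRoot z → ‖z‖ ≤ R := by
  have ho := (isLittleO_cobounded_of_degree_lt hdeg).def (c := 1 / 2) (by norm_num)
  have hA : A ≠ 0 := fun h => by simp [h] at hdeg
  have hb : Bornology.IsBounded ({z | ‖B.eval z‖ ≤ 1 / 2 * ‖A.eval z‖}ᶜ ∪ {z | A.IsRoot z}) :=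
    (Bornology.isBounded_compl_iff.2 ho).union (finite_setOfPred_isRoot hA).isBounded
  obtain ⟨R, hR⟩ := hb.exists_norm_le
  refine ⟨R, fun t ht z hz => hR z ?_⟩
  by_cases h : ‖B.eval z‖ ≤ 1 / 2 * ‖A.eval z‖
  · right
    have h1 : A.eval z = t * B.eval z := by
      have : A.eval z - t * B.eval z = 0 := by simpa using hz
      linear_combination this
    have h2 : ‖A.eval z‖ = t * ‖B.eval z‖ := by
      rw [h1, norm_mul, Complex.norm_real, Real.norm_of_nonneg ht.1]
    have h3 : t * ‖B.eval z‖ ≤ ‖B.eval z‖ := mul_le_of_le_one_left (norm_nonneg _) ht.2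
    have : ‖A.eval z‖ = 0 := by linarith [norm_nonneg (A.eval z)]
    simpa using this
  · exact Or.inl h

/-- Along `t k → t` in `[0, 1]`, the roots of `A - t k * B` converge, up to a subsequence, to those
of `A - t * B`. -/
lemma exists_subseq_homotopy_roots (hA : A.Monic) (hdeg : B.degree < A.degree) {t : ℕ → ℝ} {t' : ℝ}
    (ht : ∀ k, t k ∈ Set.Icc (0 : ℝ) 1) (hlim : Tendsto t atTop (𝓝 t')) :
    ∃ φ : ℕ → ℕ, StrictMono φ ∧ ∃ (r : ℕ → Fin A.natDegree → ℂ) (r' : Fin A.natDegree → ℂ),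
      (∀ k, A - C (t (φ k) : ℂ) * B = ∏ i, (X - C (r k i))) ∧
        A - C (t' : ℂ) * B = ∏ i, (X - C (r' i)) ∧
        ∀ i, Tendsto (fun k => r k i) atTop (𝓝 (r' i)) := by
  obtain ⟨R, hR⟩ := exists_root_bound hdeg
  refine exists_subseq_roots_tendsto (p := fun k => A - C (t k : ℂ) * B) (R := R)
    (fun k => monic_sub_C_mul hA hdeg _) (fun k => natDegree_sub_C_mul hdeg _)
    (fun k => hR _ (ht k)) fun z => ?_
  simp only [eval_sub, eval_mul, eval_C]
  exact tendsto_const_nhds.sub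
    (((Complex.continuous_ofReal.tendsto t').comp hlim).mul tendsto_const_nhds)

/-- As long as no root meets the imaginary axis, the number of roots in the open right half plane
does not change along the homotopy `A - t * B`. -/
lemma rhpCount_homotopy (hA : A.Monic) (hdeg : B.degree < A.degree)
    (hax : ∀ t ∈ Set.Ico (0 : ℝ) 1, ∀ s : ℂ, s.re = 0 → ¬ (A - C (t : ℂ) * B).IsRoot s)
    {t : ℝ} (ht : t ∈ Set.Ico (0 : ℝ) 1) :
    rhpCount (A - C (t : ℂ) * B) = rhpCount A := by
  have key : ContinuousOn (fun t : ℝ => rhpCount (A - C (t : ℂ) * B)) (Set.Ico 0 1) := by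
    intro t' ht'
    rw [ContinuousWithinAt, nhds_discrete, tendsto_pure]
    by_contra hcon
    obtain ⟨u, hu, hu'⟩ := exists_seq_forall_of_frequently
      ((not_eventually.1 hcon).and_eventually self_mem_nhdsWithin)
    obtain ⟨φ, hφ, r, r', hr, hr', hlim⟩ := exists_subseq_homotopy_roots hA hdeg
      (fun k => Set.Ico_subset_Icc_self (hu' k).2) (hu.mono_right nhdsWithin_le_nhds)
    have hre : ∀ i, (r' i).re ≠ 0 := fun i hi => by
      refine hax t' ht' (r' i) hi ?_
      rw [hr', IsRoot.def, eval_prod]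
      exact Finset.prod_eq_zero (Finset.mem_univ i) (by simp)
    -- no limit root lies on the axis, so the moving roots end up on the same side as their limits
    have hev : ∀ᶠ k in atTop, ∀ i, (0 < (r k i).re ↔ 0 < (r' i).re) := by
      refine eventually_all.2 fun i => ?_
      have h := (Complex.continuous_re.tendsto _).comp (hlim i)
      rcases lt_or_gt_of_ne (hre i) with h0 | h0
      · filter_upwards [h.eventually_lt_const h0] with k hk
        exact iff_of_false (not_lt.2 hk.le) (not_lt.2 h0.le)
      · filter_upwards [h.eventually_const_lt h0] with k hk
        exact iff_of_true hk h0
    obtain ⟨k, hk⟩ := hev.exists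
    refine (hu' (φ k)).1 ?_
    rw [hr k, hr', rhpCount_prod, rhpCount_prod]
    simp only [hk]
  have h0 : (0 : ℝ) ∈ Set.Ico (0 : ℝ) 1 := by simp
  simpa using isPreconnected_Ico.constant key ht h0

/-- Tracking the roots of `A - t * B` as `t → 1⁻`: the indices of the roots that lie in the open
right half plane form a fixed set `S`, whose size is the number of such roots of `A`. -/
lemma exists_tracked_roots (hA : A.Monic) (hdeg : B.degree < A.degree)
    (hax : ∀ t ∈ Set.Ico (0 : ℝ) 1, ∀ s : ℂ, s.re = 0 → ¬ (A - C (t : ℂ) * B).IsRoot s) :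
    ∃ (t : ℕ → ℝ) (r : ℕ → Fin A.natDegree → ℂ) (r' : Fin A.natDegree → ℂ)
      (S : Finset (Fin A.natDegree)),
      (∀ k, t k ∈ Set.Ioo (0 : ℝ) 1) ∧ Tendsto t atTop (𝓝 1) ∧
      (∀ k, A - C (t k : ℂ) * B = ∏ i, (X - C (r k i))) ∧ A - B = ∏ i, (X - C (r' i)) ∧
      (∀ i, Tendsto (fun k => r k i) atTop (𝓝 (r' i))) ∧ S.card = rhpCount A ∧
      ∀ k i, i ∈ S ↔ 0 < (r k i).re := by
  obtain ⟨u, -, hu, hu1⟩ := exists_seq_strictMono_tendsto' (zero_lt_one (α := ℝ))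
  obtain ⟨φ, hφ, r, r', hr, hr', hlim⟩ := exists_subseq_homotopy_roots hA hdeg
    (fun k => Set.Ioo_subset_Icc_self (hu k)) hu1
  have hS : ∃ S : Finset (Fin A.natDegree),
      ∃ᶠ k in atTop, Finset.univ.filter (fun i => 0 < (r k i).re) = S := by
    by_contra! h
    obtain ⟨k, hk⟩ := (eventually_all.2 h).exists
    exact hk _ rfl
  obtain ⟨S, hS⟩ := hS
  obtain ⟨ψ, hψ, hψS⟩ := extraction_of_frequently_atTop hS
  refine ⟨fun k => u (φ (ψ k)), fun k => r (ψ k), r', S, fun k => hu _,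
    hu1.comp (hφ.tendsto_atTop.comp hψ.tendsto_atTop), fun k => hr _, by simpa using hr',
    fun i => (hlim i).comp hψ.tendsto_atTop, ?_, fun k i => ?_⟩
  · rw [← hψS 0, ← rhpCount_prod, ← hr]
    exact rhpCount_homotopy hA hdeg hax (Set.Ioo_subset_Ico_self (hu _))
  · rw [← hψS k]
    simp

end Homotopy

/-! ### Direction of a root near a point where `L = 1` -/

section LocalRoots

variable {L : ℂ → ℂ} {L' s₀ : ℂ} {z : ℕ → ℂ} {x : ℕ → ℝ}

/-- If `L (z k) = 1 + x k` with `z k → s₀`, the ratio `x k / (z k - s₀)` is a difference quotient of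
`L`. As `x k > 0`, the sign of `Re (L' s₀)` tells from which side of the axis `z k` arrives. -/
lemma tendsto_div_sub_of_eq_one_add (hL : HasDerivAt L L' s₀) (h1 : L s₀ = 1)
    (hz : Tendsto z atTop (𝓝 s₀)) (hx : ∀ k, 0 < x k) (hLz : ∀ᶠ k in atTop, L (z k) = 1 + x k) :
    Tendsto (fun k => ((x k : ℝ) : ℂ) / (z k - s₀)) atTop (𝓝 L') := by
  have hne : ∀ᶠ k in atTop, z k ≠ s₀ := by
    filter_upwards [hLz] with k hk h0
    rw [h0, h1] at hk
    have : (x k : ℂ) = 0 := by linear_combination -hk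
    exact (hx k).ne' (by exact_mod_cast this)
  have := (hasDerivAt_iff_tendsto_slope.1 hL).comp
    (tendsto_nhdsWithin_iff.2 ⟨hz, hne⟩)
  refine this.congr' ?_
  filter_upwards [hLz] with k hk
  simp only [Function.comp, slope_def_field, hk, h1]
  ring

lemma ofReal_div_re (x : ℝ) (w : ℂ) : ((x : ℂ) / w).re = x * w.re / Complex.normSq w := by
  simp [Complex.div_re]

lemma re_deriv_nonneg_of_tendsto (hL : HasDerivAt L L' s₀) (h1 : L s₀ = 1)
    (hz : Tendsto z atTop (𝓝 s₀)) (hx : ∀ k, 0 < x k) (hLz : ∀ᶠ k in atTop, L (z k) = 1 + x k)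
    (hre : ∀ k, 0 < (z k - s₀).re) : 0 ≤ L'.re := by
  have := (Complex.continuous_re.tendsto _).comp (tendsto_div_sub_of_eq_one_add hL h1 hz hx hLz)
  refine ge_of_tendsto' this fun k => ?_
  simp only [Function.comp, ofReal_div_re]
  exact div_nonneg (mul_nonneg (hx k).le (hre k).le) (Complex.normSq_nonneg _)

lemma eventually_re_pos_of_re_deriv_pos (hL : HasDerivAt L L' s₀) (h1 : L s₀ = 1)
    (hz : Tendsto z atTop (𝓝 s₀)) (hx : ∀ k, 0 < x k) (hLz : ∀ᶠ k in atTop, L (z k) = 1 + x k)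
    (hL' : 0 < L'.re) : ∀ᶠ k in atTop, 0 < (z k - s₀).re := by
  have := (Complex.continuous_re.tendsto _).comp (tendsto_div_sub_of_eq_one_add hL h1 hz hx hLz)
  filter_upwards [this.eventually_const_lt hL'] with k hk
  simp only [Function.comp, ofReal_div_re] at hk
  by_contra! hcon
  exact hk.not_ge (div_nonpos_of_nonpos_of_nonneg
    (mul_nonpos_of_nonneg_of_nonpos (hx k).le hcon) (Complex.normSq_nonneg _))

/-- If `|L|` has on the imaginary axis a maximum at `s₀`, with `L s₀ = 1`, then `L' s₀` is real. -/
lemma im_deriv_eq_zero (hL : HasDerivAt L L' s₀) (h1 : L s₀ = 1)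
    (hmax : ∀ ω : ℝ, ‖L (s₀ + Complex.I * ω)‖ ≤ 1) : L'.im = 0 := by
  have h2 : HasDerivAt (fun ω : ℝ => L (s₀ + Complex.I * (ω : ℂ))) (L' * Complex.I) 0 := by
    have hL0 : HasDerivAt L L' (s₀ + Complex.I * ((0 : ℝ) : ℂ)) := by simpa using hL
    have hin : HasDerivAt (fun w : ℂ => s₀ + Complex.I * w) Complex.I ((0 : ℝ) : ℂ) := by
      simpa using ((hasDerivAt_id ((0 : ℝ) : ℂ)).const_mul Complex.I).const_add s₀
    exact (HasDerivAt.comp (h := fun w : ℂ => s₀ + Complex.I * w) _ hL0 hin).comp_ofReal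
  have h3 : HasDerivAt (fun ω : ℝ => (L (s₀ + Complex.I * (ω : ℂ))).re) (L' * Complex.I).re 0 :=
    Complex.reCLM.hasFDerivAt.comp_hasDerivAt _ h2
  have hm : IsLocalMax (fun ω : ℝ => (L (s₀ + Complex.I * (ω : ℂ))).re) 0 := by
    refine Eventually.of_forall fun ω => ?_
    simp only [Complex.ofReal_zero, mul_zero, add_zero, h1, Complex.one_re]
    exact (Complex.re_le_norm _).trans (hmax ω)
  have := hm.hasDerivAt_eq_zero h3
  simpa using this

end LocalRoots

/-! ### Crossings of the imaginary axis -/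

section Counting

variable {A B : ℂ[X]}

lemma hasDerivAt_eval_div (s : ℂ) (hA : A.eval s ≠ 0) :
    HasDerivAt (fun s => B.eval s / A.eval s) (deriv (fun s => B.eval s / A.eval s) s) s :=
  (B.differentiableAt.fun_div A.differentiableAt hA).hasDerivAt

/-- Where `B / A` takes the value `1`, its derivative is `-(A - B)' / A`. -/
lemma deriv_eval_div_of_isRoot {s : ℂ} (hA : A.eval s ≠ 0) (hs : (A - B).IsRoot s) :
    A.eval s * deriv (fun s => B.eval s / A.eval s) s = -(derivative (A - B)).eval s := by
  have h1 : A.eval s = B.eval s := by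
    have : A.eval s - B.eval s = 0 := by simpa using hs
    linear_combination this
  rw [deriv_fun_div B.differentiableAt A.differentiableAt hA]
  simp only [Polynomial.deriv, derivative_sub, eval_sub]
  field_simp
  rw [h1]
  ring

lemma rootMultiplicity_eq_one_iff {s : ℂ} (hA : A.eval s ≠ 0) (hs : (A - B).IsRoot s)
    (h0 : A - B ≠ 0) :
    (A - B).rootMultiplicity s = 1 ↔ deriv (fun s => B.eval s / A.eval s) s ≠ 0 := by
  have h1 := (rootMultiplicity_pos h0).2 hs
  have h2 := one_lt_rootMultiplicity_iff_isRoot (t := s) h0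
  have h3 := deriv_eval_div_of_isRoot hA hs
  constructor
  · intro h hd
    rw [hd, mul_zero] at h3
    have := h2.2 ⟨hs, by rw [IsRoot.def]; linear_combination h3⟩
    omega
  · intro h
    have : ¬ 1 < (A - B).rootMultiplicity s := fun hlt => by
      have h4 : (derivative (A - B)).eval s = 0 := (h2.1 hlt).2
      rw [h4, neg_zero] at h3
      exact mul_ne_zero hA h h3
    omega

lemma sub_ne_zero_of_degree_lt (hdeg : B.degree < A.degree) : A - B ≠ 0 := fun h => by
  rw [sub_eq_zero.1 h] at hdeg
  exact lt_irrefl _ hdeg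

lemma not_isRoot_homotopy (hax : ∀ s : ℂ, s.re = 0 → A.eval s ≠ 0)
    (hle : ∀ s : ℂ, s.re = 0 → ‖B.eval s‖ ≤ ‖A.eval s‖) :
    ∀ t ∈ Set.Ico (0 : ℝ) 1, ∀ s : ℂ, s.re = 0 → ¬ (A - C (t : ℂ) * B).IsRoot s := by
  intro t ht s hs hr
  have h1 : A.eval s = t * B.eval s := by
    have : A.eval s - t * B.eval s = 0 := by simpa using hr
    linear_combination this
  have h2 : ‖A.eval s‖ = t * ‖B.eval s‖ := by
    rw [h1, norm_mul, Complex.norm_real, Real.norm_of_nonneg ht.1]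
  have h3 := norm_pos_iff.2 (hax s hs)
  nlinarith [hle s hs, ht.1, ht.2, norm_nonneg (B.eval s)]

/-- The roots of `A - t * B` are the points at which `B / A` equals `1 / t`. -/
lemma eventually_eval_div_eq {t : ℕ → ℝ} {z : ℕ → ℂ} {s : ℂ} (hA : A.eval s ≠ 0)
    (ht : ∀ k, t k ∈ Set.Ioo (0 : ℝ) 1) (hz : Tendsto z atTop (𝓝 s))
    (hr : ∀ k, (A - C (t k : ℂ) * B).IsRoot (z k)) :
    ∀ᶠ k in atTop, B.eval (z k) / A.eval (z k) = 1 + (((t k)⁻¹ - 1 : ℝ) : ℂ) := by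
  filter_upwards [((A.continuous.tendsto s).comp hz).eventually_ne hA] with k hk
  have hk' : A.eval (z k) ≠ 0 := hk
  have h1 : A.eval (z k) = t k * B.eval (z k) := by
    have : A.eval (z k) - t k * B.eval (z k) = 0 := by simpa using hr k
    linear_combination this
  have ht0 : (t k : ℂ) ≠ 0 := by exact_mod_cast (ht k).1.ne'
  rw [div_eq_iff hk', h1]
  push_cast
  field_simp
  ring

lemma isRoot_prod_X_sub_C {m : ℕ} {p : ℂ[X]} {r : Fin m → ℂ} (hp : p = ∏ i, (X - C (r i)))
    {s : ℂ} : p.IsRoot s ↔ ∃ i, s = r i := by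
  rw [hp, IsRoot.def, eval_prod, Finset.prod_eq_zero_iff]
  simp [sub_eq_zero]

lemma norm_eval_div_le (hle : ∀ s : ℂ, s.re = 0 → ‖B.eval s‖ ≤ ‖A.eval s‖) {s : ℂ}
    (hs : s.re = 0) (ω : ℝ) :
    ‖B.eval (s + Complex.I * ω) / A.eval (s + Complex.I * ω)‖ ≤ 1 := by
  rw [norm_div]
  exact div_le_one_of_le₀ (hle _ (by simp [hs])) (norm_nonneg _)

/-- If all roots of `A - B` in the closed right half plane are simple and on the imaginary axis,
then as many of them as `A` has roots in the open right half plane are crossed by roots of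
`A - t * B` that come from the right; there `B / A` has a positive derivative. When there is just
one and the polynomials are real, the moving root is real, so its limit is `0`. -/
theorem exists_crossings (hA : A.Monic) (hdeg : B.degree < A.degree)
    (hax : ∀ s : ℂ, s.re = 0 → A.eval s ≠ 0)
    (hle : ∀ s : ℂ, s.re = 0 → ‖B.eval s‖ ≤ ‖A.eval s‖)
    (hstab : ∀ s : ℂ, 0 ≤ s.re → (A - B).IsRoot s →
      s.re = 0 ∧ (A - B).rootMultiplicity s = 1)
    (hconj : ∀ (t : ℝ) (s : ℂ), (A - C (t : ℂ) * B).IsRoot s →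
      (A - C (t : ℂ) * B).IsRoot ((starRingEnd ℂ) s)) :
    ∃ Z : Finset ℂ, Z.card = rhpCount A ∧
      (∀ s ∈ Z, s.re = 0 ∧ (A - B).IsRoot s ∧
        0 < (deriv (fun s => B.eval s / A.eval s) s).re) ∧
      (Z.card = 1 → ∀ s ∈ Z, s = 0) := by
  obtain ⟨t, r, r', S, ht, ht1, hr, hr', hlim, hcard, hS⟩ :=
    exists_tracked_roots hA hdeg (not_isRoot_homotopy hax hle)
  have hAB : A - B ≠ 0 := sub_ne_zero_of_degree_lt hdeg
  have hroot : ∀ i, (A - B).IsRoot (r' i) := fun i => (isRoot_prod_X_sub_C hr').2 ⟨i, rfl⟩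
  have hrootk : ∀ k i, (A - C (t k : ℂ) * B).IsRoot (r k i) := fun k i =>
    (isRoot_prod_X_sub_C (hr k)).2 ⟨i, rfl⟩
  have hre0 : ∀ i ∈ S, 0 ≤ (r' i).re := fun i hi =>
    ge_of_tendsto' ((Complex.continuous_re.tendsto _).comp (hlim i)) fun k => ((hS k i).1 hi).le
  have hre : ∀ i ∈ S, (r' i).re = 0 := fun i hi => (hstab _ (hre0 i hi) (hroot i)).1
  -- two tracked roots with the same limit would make that limit a multiple root
  have hinj : Set.InjOn r' S := by
    intro i hi j hj hij
    by_contra hne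
    have hdvd : (X - C (r' i)) ^ 2 ∣ A - B := by
      rw [hr', sq]
      have h1 : (X - C (r' i)) * (X - C (r' i)) = ∏ l ∈ {i, j}, (X - C (r' l)) := by
        rw [Finset.prod_pair hne, hij]
      rw [h1]
      exact Finset.prod_dvd_prod_of_subset _ _ _ (Finset.subset_univ _)
    have h2 := (le_rootMultiplicity_iff hAB).2 hdvd
    rw [(hstab _ (hre0 i hi) (hroot i)).2] at h2
    omega
  refine ⟨S.image r', by rw [Finset.card_image_of_injOn hinj, hcard], ?_, ?_⟩
  · intro s hs
    obtain ⟨i, hi, rfl⟩ := Finset.mem_image.1 hs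
    have hAi := hax _ (hre i hi)
    have hL := hasDerivAt_eval_div (B := B) (r' i) hAi
    have h1 : B.eval (r' i) / A.eval (r' i) = 1 := by
      rw [div_eq_one_iff_eq hAi]
      have : A.eval (r' i) - B.eval (r' i) = 0 := by simpa using hroot i
      linear_combination -this
    refine ⟨hre i hi, hroot i, ?_⟩
    have hge := re_deriv_nonneg_of_tendsto hL h1 (hlim i) (x := fun k => (t k)⁻¹ - 1)
      (fun k => sub_pos.2 ((one_lt_inv₀ (ht k).1).2 (ht k).2))
      (eventually_eval_div_eq hAi ht (hlim i) fun k => hrootk k i)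
      (fun k => by rw [Complex.sub_re, hre i hi, sub_zero]; exact (hS k i).1 hi)
    have him := im_deriv_eq_zero hL h1 (norm_eval_div_le hle (hre i hi))
    refine lt_of_le_of_ne hge fun h0 => ?_
    exact (rootMultiplicity_eq_one_iff hAi (hroot i) hAB).1
      (hstab _ (hre0 i hi) (hroot i)).2 (Complex.ext h0.symm him)
  · intro hone s hs
    obtain ⟨i, hi, rfl⟩ := Finset.mem_image.1 hs
    rw [Finset.card_image_of_injOn hinj] at hone
    obtain ⟨i', hS1⟩ := Finset.card_eq_one.1 hone
    have huniq : ∀ j ∈ S, j = i := fun j hj => by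
      rw [hS1, Finset.mem_singleton] at hi hj
      rw [hi, hj]
    -- the conjugate of the only root in the open right half plane is again such a root
    have him : ∀ k, (r k i).im = 0 := fun k => by
      obtain ⟨j, hj⟩ := (isRoot_prod_X_sub_C (hr k)).1 (hconj _ _ (hrootk k i))
      have hjS : j ∈ S := (hS k j).2 (by rw [← hj]; simpa using (hS k i).1 hi)
      rw [huniq j hjS] at hj
      exact Complex.conj_eq_iff_im.1 hj
    refine Complex.ext (hre i hi) ?_
    refine tendsto_nhds_unique ((Complex.continuous_im.tendsto _).comp (hlim i)) ?_
    simp [Function.comp_def, him]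

/-- If `|B| < |A|` on the imaginary axis off a set `Z` of points at which `B / A` is `1` with a
derivative of positive real part, and `Z` has as many points as `A` has roots in the open right half
plane, then all those roots are accounted for: `A - B` has no root in the open right half plane, and
those on the axis are simple. -/
theorem simple_roots_of_crossings (hA : A.Monic) (hdeg : B.degree < A.degree)
    (hax : ∀ s : ℂ, s.re = 0 → A.eval s ≠ 0)
    (hle : ∀ s : ℂ, s.re = 0 → ‖B.eval s‖ ≤ ‖A.eval s‖)
    {Z : Finset ℂ} (hcard : Z.card = rhpCount A)
    (hlt : ∀ s : ℂ, s.re = 0 → s ∉ Z → ‖B.eval s‖ < ‖A.eval s‖)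
    (hZ : ∀ s ∈ Z, s.re = 0 ∧ (A - B).IsRoot s ∧
        0 < (deriv (fun s => B.eval s / A.eval s) s).re) :
    ∀ s : ℂ, 0 ≤ s.re → (A - B).IsRoot s →
      s.re = 0 ∧ (A - B).rootMultiplicity s = 1 := by
  obtain ⟨t, r, r', S, ht, ht1, hr, hr', hlim, hcardS, hS⟩ :=
    exists_tracked_roots hA hdeg (not_isRoot_homotopy hax hle)
  have hAB : A - B ≠ 0 := sub_ne_zero_of_degree_lt hdeg
  have hrootk : ∀ k i, (A - C (t k : ℂ) * B).IsRoot (r k i) := fun k i =>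
    (isRoot_prod_X_sub_C (hr k)).2 ⟨i, rfl⟩
  -- at a point of `Z` a root arrives from the right, which uses up one index of `S`
  have hmem : Z ⊆ S.image r' := by
    intro s hs
    obtain ⟨hs0, hsr, hpos⟩ := hZ s hs
    obtain ⟨i, rfl⟩ := (isRoot_prod_X_sub_C hr').1 hsr
    have hAi := hax _ hs0
    have h1 : B.eval (r' i) / A.eval (r' i) = 1 := by
      rw [div_eq_one_iff_eq hAi]
      have : A.eval (r' i) - B.eval (r' i) = 0 := by simpa using hsr
      linear_combination -this
    obtain ⟨k, hk⟩ := (eventually_re_pos_of_re_deriv_pos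
      (hasDerivAt_eval_div (B := B) (r' i) hAi) h1 (hlim i) (x := fun k => (t k)⁻¹ - 1)
      (fun k => sub_pos.2 ((one_lt_inv₀ (ht k).1).2 (ht k).2))
      (eventually_eval_div_eq hAi ht (hlim i) fun k => hrootk k i) hpos).exists
    rw [Complex.sub_re, hs0, sub_zero] at hk
    exact Finset.mem_image_of_mem _ ((hS k i).2 hk)
  have heq : Z = S.image r' :=
    Finset.eq_of_subset_of_card_le hmem (Finset.card_image_le.trans (by rw [hcard, hcardS]))
  intro s hs hsr
  rcases hs.eq_or_lt with h0 | h0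
  · have hsZ : s ∈ Z := by
      by_contra hn
      have h1 : A.eval s - B.eval s = 0 := by simpa using hsr
      exact (hlt s h0.symm hn).ne (by rw [sub_eq_zero.1 h1])
    refine ⟨h0.symm, (rootMultiplicity_eq_one_iff (hax s h0.symm) hsr hAB).2 fun hd => ?_⟩
    have := (hZ s hsZ).2.2
    simp [hd] at this
  · exfalso
    obtain ⟨i, rfl⟩ := (isRoot_prod_X_sub_C hr').1 hsr
    obtain ⟨k, hk⟩ := (((Complex.continuous_re.tendsto _).comp
      (hlim i)).eventually_const_lt h0).exists
    have hi : r' i ∈ Z := heq ▸ Finset.mem_image_of_mem _ ((hS k i).2 hk)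
    exact h0.ne' (hZ _ hi).1

end Counting

/-! ### The Schwarz-Pick inequality in the right half plane and on its boundary -/

section Schwarz

lemma norm_sub_le_norm_one_sub_conj_mul {a b : ℂ} (ha : ‖a‖ ≤ 1) (hb : ‖b‖ ≤ 1) :
    ‖a - b‖ ≤ ‖1 - conj b * a‖ := by
  rw [← sq_le_sq₀ (norm_nonneg _) (norm_nonneg _), Complex.sq_norm, Complex.sq_norm]
  have ha' : Complex.normSq a ≤ 1 := by
    rw [← Complex.sq_norm]; exact pow_le_one₀ (norm_nonneg _) ha
  have hb' : Complex.normSq b ≤ 1 := by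
    rw [← Complex.sq_norm]; exact pow_le_one₀ (norm_nonneg _) hb
  rw [Complex.normSq_apply] at *
  simp only [Complex.sub_re, Complex.sub_im, Complex.mul_re, Complex.mul_im, Complex.conj_re,
    Complex.conj_im, Complex.one_re, Complex.one_im, Complex.normSq_apply] at *
  nlinarith [mul_nonneg (sub_nonneg.2 ha') (sub_nonneg.2 hb')]

variable {F : ℂ → ℂ}

/-- The Schwarz-Pick inequality between `z` and `conj z`, for a function of norm less than `1` on the
right half plane that is real on the real axis. -/
lemma schwarz_pick_conj_of_lt (hd : DifferentiableOn ℂ F {s | 0 < s.re})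
    (hF : ∀ s : ℂ, 0 < s.re → ‖F s‖ < 1) (hc : ∀ s, F (conj s) = conj (F s)) {z : ℂ}
    (hz : 0 < z.re) : ‖F z - conj (F z)‖ * ‖z‖ ≤ ‖1 - F z * F z‖ * |z.im| := by
  have hz0 : z ≠ 0 := fun h => by simp [h] at hz
  -- the disc is mapped to the half plane by `φ`, which takes `0` to `conj z` and `ζ₀` to `z`
  set φ : ℂ → ℂ := fun ζ => (conj z + z * ζ) / (1 - ζ) with hφ
  set G : ℂ → ℂ := fun s => (F s - conj (F z)) / (1 - F z * F s) with hG
  set ζ₀ : ℂ := (z - conj z) / (2 * z) with hζ₀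
  have hne : ∀ ζ ∈ Metric.ball (0 : ℂ) 1, 1 - ζ ≠ 0 := fun ζ hζ h => by
    rw [mem_ball_zero_iff, ← sub_eq_zero.1 h] at hζ
    simp at hζ
  have hφre : ∀ ζ ∈ Metric.ball (0 : ℂ) 1, 0 < (φ ζ).re := fun ζ hζ => by
    have h1 := Complex.normSq_pos.2 (hne ζ hζ)
    have h2 : Complex.normSq ζ < 1 := by
      rw [← Complex.sq_norm]
      exact pow_lt_one₀ (norm_nonneg _) (mem_ball_zero_iff.1 hζ) two_ne_zero
    have h3 : (φ ζ).re = z.re * (1 - Complex.normSq ζ) / Complex.normSq (1 - ζ) := by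
      simp only [hφ, Complex.div_re]
      rw [← add_div]
      congr 1
      simp [Complex.normSq_apply]
      ring
    rw [h3]
    exact div_pos (mul_pos hz (by linarith)) h1
  have hGden : ∀ s : ℂ, 0 < s.re → 1 - F z * F s ≠ 0 := fun s hs h => by
    have h1 : ‖F z * F s‖ < 1 := by
      rw [norm_mul]
      exact mul_lt_one_of_nonneg_of_lt_one_left (norm_nonneg _) (hF z hz) (hF s hs).le
    rw [← sub_eq_zero.1 h] at h1
    simp at h1
  have hmaps : Set.MapsTo (G ∘ φ) (Metric.ball 0 1) (Metric.closedBall 0 1) := fun ζ hζ => by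
    rw [mem_closedBall_zero_iff, Function.comp, hG, norm_div]
    have h2 := norm_sub_le_norm_one_sub_conj_mul (hF (φ ζ) (hφre ζ hζ)).le
      (b := conj (F z)) (by rw [RCLike.norm_conj]; exact (hF z hz).le)
    rw [Complex.conj_conj] at h2
    exact div_le_one_of_le₀ h2 (norm_nonneg _)
  have hdiff : DifferentiableOn ℂ (G ∘ φ) (Metric.ball 0 1) := by
    have h1 : DifferentiableOn ℂ G {s | 0 < s.re} :=
      (hd.sub_const _).div ((differentiableOn_const _).sub (hd.const_mul _)) hGden
    have h2 : DifferentiableOn ℂ φ (Metric.ball 0 1) :=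
      DifferentiableOn.div (by fun_prop) (by fun_prop) hne
    exact h1.comp h2 hφre
  have h0 : (G ∘ φ) 0 = 0 := by simp [hφ, hG, hc]
  have hnum : ‖z - conj z‖ = 2 * |z.im| := by
    rw [Complex.sub_conj]
    simp
  have hζn : ‖ζ₀‖ = |z.im| / ‖z‖ := by
    rw [hζ₀, norm_div, hnum, norm_mul]
    simp only [Complex.norm_ofNat]
    exact mul_div_mul_left _ _ two_ne_zero
  have hζ1 : ‖ζ₀‖ < 1 := by
    rw [hζn, div_lt_one (norm_pos_iff.2 hz0)]
    exact Complex.abs_im_lt_norm.2 hz.ne'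
  have hφζ : φ ζ₀ = z := by
    have h1 := hne ζ₀ (mem_ball_zero_iff.2 hζ1)
    rw [hφ, div_eq_iff h1, hζ₀]
    field_simp
    ring
  have key := Complex.norm_le_norm_of_mapsTo_ball hdiff hmaps h0 hζ1
  rw [Function.comp, hφζ, hG, hζn, norm_div, div_le_div_iff₀ (norm_pos_iff.2 (hGden z hz))
    (norm_pos_iff.2 hz0)] at key
  linarith

/-- The Schwarz-Pick inequality squared: the identity
`|1 - w²|² = (1 - |w|²)² + 4 (Im w)²` separates the modulus of `F` from its imaginary part. -/
lemma two_mul_re_mul_abs_im_le_of_lt (hd : DifferentiableOn ℂ F {s | 0 < s.re})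
    (hF : ∀ s : ℂ, 0 < s.re → ‖F s‖ < 1) (hc : ∀ s, F (conj s) = conj (F s)) {z : ℂ}
    (hz : 0 < z.re) : 2 * z.re * |(F z).im| ≤ (1 - ‖F z‖ ^ 2) * |z.im| := by
  have h := schwarz_pick_conj_of_lt hd hF hc hz
  have h1 : 0 ≤ 1 - ‖F z‖ ^ 2 :=
    sub_nonneg.2 (pow_le_one₀ (norm_nonneg _) (hF z hz).le)
  rw [← sq_le_sq₀ (by positivity) (by positivity)] at h ⊢
  simp only [mul_pow, sq_abs, Complex.sq_norm, Complex.normSq_apply] at h ⊢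
  simp at h
  nlinarith

/-- A function of norm at most `1` on the right half plane, real on the real axis, satisfies
`2 Re z |Im F(z)| ≤ (1 - |F(z)|²) |Im z|` there. -/
lemma two_mul_re_mul_abs_im_le (hd : DifferentiableOn ℂ F {s | 0 < s.re})
    (hF : ∀ s : ℂ, 0 < s.re → ‖F s‖ ≤ 1) (hc : ∀ s, F (conj s) = conj (F s)) {z : ℂ}
    (hz : 0 < z.re) : 2 * z.re * |(F z).im| ≤ (1 - ‖F z‖ ^ 2) * |z.im| := by
  -- scaling `F` by `ρ < 1` makes the bound strict; then `ρ → 1`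
  have key : ∀ ρ ∈ Set.Ioo (0 : ℝ) 1,
      2 * z.re * |ρ * (F z).im| ≤ (1 - (ρ * ‖F z‖) ^ 2) * |z.im| := fun ρ hρ => by
    have := two_mul_re_mul_abs_im_le_of_lt (F := fun s => (ρ : ℂ) * F s) (hd.const_mul _)
      (fun s hs => by
        rw [norm_mul, Complex.norm_real, Real.norm_of_nonneg hρ.1.le]
        exact mul_lt_one_of_nonneg_of_lt_one_left hρ.1.le hρ.2 (hF s hs))
      (fun s => by simp [hc]) hz
    simpa [Real.norm_of_nonneg hρ.1.le, abs_of_pos hρ.1] using this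
  have h1 : ContinuousWithinAt (fun ρ : ℝ => 2 * z.re * |ρ * (F z).im|) (Set.Ioo 0 1) 1 := by
    fun_prop
  have h2 : ContinuousWithinAt (fun ρ : ℝ => (1 - (ρ * ‖F z‖) ^ 2) * |z.im|) (Set.Ioo 0 1) 1 := by
    fun_prop
  have : (𝓝[Set.Ioo (0 : ℝ) 1] 1).NeBot := by
    rw [← mem_closure_iff_nhdsWithin_neBot, closure_Ioo zero_ne_one]
    simp
  have := le_of_tendsto_of_tendsto h1 h2 (eventually_nhdsWithin_of_forall key)
  simpa using this

/-- Where `|F| = 1`, the rate at which `|F|²` falls below `1` to the right of `s₀`. -/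
lemma tendsto_one_sub_norm_sq_div {F' s₀ : ℂ} (hF' : HasDerivAt F F' s₀) (h1 : ‖F s₀‖ = 1) :
    Tendsto (fun ε : ℝ => (1 - ‖F (s₀ + ε)‖ ^ 2) / ε) (𝓝[>] 0)
      (𝓝 (-(2 * (F' * conj (F s₀)).re))) := by
  have hF0 : HasDerivAt F F' (s₀ + ((0 : ℝ) : ℂ)) := by simpa using hF'
  have hin : HasDerivAt (fun w : ℂ => s₀ + w) 1 ((0 : ℝ) : ℂ) :=
    (hasDerivAt_id _).const_add s₀
  have h2 : HasDerivAt (fun ε : ℝ => F (s₀ + (ε : ℂ))) F' 0 := by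
    simpa using (HasDerivAt.comp (h := fun w : ℂ => s₀ + w) _ hF0 hin).comp_ofReal
  have h3 := h2.norm_sq
  have h4 := (hasDerivAt_iff_tendsto_slope.1 h3).mono_left
    (nhdsWithin_mono 0 (fun x (hx : 0 < x) => hx.ne'))
  have h5 := h4.neg
  simp only [Complex.ofReal_zero, add_zero] at h5
  have e : inner ℝ (F s₀) F' = (F' * conj (F s₀)).re := rfl
  rw [e] at h5
  refine h5.congr fun ε => ?_
  simp [slope_def_field, h1]
  ring

/-- The boundary version of the Schwarz-Pick inequality: the phase of `F` decreases along the
imaginary axis at least at the rate `|Im F(s₀)| / |Im s₀|` at a point where `|F| = 1`. -/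
lemma abs_im_le_neg_re_deriv_mul {F' s₀ : ℂ} (hd : DifferentiableOn ℂ F {s | 0 < s.re})
    (hF : ∀ s : ℂ, 0 < s.re → ‖F s‖ ≤ 1) (hc : ∀ s, F (conj s) = conj (F s))
    (hs₀ : s₀.re = 0) (hF' : HasDerivAt F F' s₀) (h1 : ‖F s₀‖ = 1) :
    |(F s₀).im| ≤ -(F' * conj (F s₀)).re * |s₀.im| := by
  have hl := tendsto_one_sub_norm_sq_div hF' h1
  have hcont : Tendsto (fun ε : ℝ => |(F (s₀ + ε)).im|) (𝓝[>] 0) (𝓝 |(F s₀).im|) := by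
    have h2 : Tendsto (fun ε : ℝ => s₀ + (ε : ℂ)) (𝓝[>] 0) (𝓝 s₀) := by
      have : Continuous fun ε : ℝ => s₀ + (ε : ℂ) := by fun_prop
      simpa using (this.tendsto 0).mono_left nhdsWithin_le_nhds
    exact ((Complex.continuous_im.tendsto _).comp (hF'.continuousAt.tendsto.comp h2)).abs
  have hr := (hl.div_const 2).mul_const |s₀.im|
  have := le_of_tendsto_of_tendsto hcont hr (by
    filter_upwards [self_mem_nhdsWithin] with ε (hε : 0 < ε)
    have h3 := two_mul_re_mul_abs_im_le hd hF hc (z := s₀ + ε) (by simpa [hs₀] using hε)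
    simp only [Complex.add_re, hs₀, Complex.ofReal_re, zero_add, Complex.add_im,
      Complex.ofReal_im, add_zero] at h3
    rw [div_div, div_mul_eq_mul_div, le_div_iff₀ (by positivity)]
    linarith)
  linarith

lemma re_deriv_mul_conj_nonpos {F' s₀ : ℂ} (hF : ∀ s : ℂ, 0 < s.re → ‖F s‖ ≤ 1)
    (hs₀ : s₀.re = 0) (hF' : HasDerivAt F F' s₀) (h1 : ‖F s₀‖ = 1) :
    (F' * conj (F s₀)).re ≤ 0 := by
  have hl := tendsto_one_sub_norm_sq_div hF' h1
  have := ge_of_tendsto hl (b := 0) (by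
    filter_upwards [self_mem_nhdsWithin] with ε (hε : 0 < ε)
    refine div_nonneg (sub_nonneg.2 (pow_le_one₀ (norm_nonneg _) (hF _ ?_))) hε.le
    simpa [hs₀] using hε)
  linarith

end Schwarz

/-! ### Values, symmetry and phase of real rational functions -/

section Values

variable {f g : RatFunc ℝ}

lemma value_eq_aeval_div (h : RatFunc ℝ) (s : ℂ) : value h s = aeval s h.num / aeval s h.denom := rfl

lemma value_conj (h : RatFunc ℝ) (s : ℂ) : value h (conj s) = conj (value h s) := by
  rw [value_eq_aeval_div, value_eq_aeval_div, map_div₀, aeval_conj, aeval_conj]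

lemma differentiableAt_value {h : RatFunc ℝ} {s : ℂ} (hs : ¬ IsPole h s) :
    DifferentiableAt ℂ (value h) s := by
  have e : value h = fun s => aeval s h.num / aeval s h.denom := rfl
  rw [e]
  exact (h.num.differentiableAt_aeval).fun_div (h.denom.differentiableAt_aeval) hs

lemma eq_I_mul_of_re_eq_zero {s : ℂ} (hs : s.re = 0) : s = Complex.I * (s.im : ℂ) := by
  apply Complex.ext <;> simp [hs]

lemma not_isPole_of_re_eq_zero (hg : IsRLInf g) {s : ℂ} (hs : s.re = 0) : ¬ IsPole g s := by
  rw [eq_I_mul_of_re_eq_zero hs]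
  exact hg.1 _

lemma value_of_re_eq_zero (g : RatFunc ℝ) {s : ℂ} (hs : s.re = 0) :
    value g s = freqResp g s.im := by
  rw [freqResp, ← eq_I_mul_of_re_eq_zero hs]

lemma freqResp_neg (g : RatFunc ℝ) (ω : ℝ) : freqResp g (-ω) = conj (freqResp g ω) := by
  rw [freqResp, freqResp, ← value_conj]
  congr 1
  simp

/-- The derivative of the phase of `g(jω)` is the real part of the logarithmic derivative of `g`. -/
lemma deriv_phase {ω₀ : ℝ} {θ : ℝ → ℝ} (hθ : IsPhaseNear g ω₀ θ)
    (hp : ¬ IsPole g (Complex.I * (ω₀ : ℂ))) (h0 : freqResp g ω₀ ≠ 0) :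
    deriv θ ω₀ = (deriv (value g) (Complex.I * ω₀) / value g (Complex.I * ω₀)).re := by
  set s₀ : ℂ := Complex.I * ω₀ with hs₀
  have hg := (differentiableAt_value hp).hasDerivAt
  have hin : HasDerivAt (fun w : ℂ => Complex.I * w) Complex.I (ω₀ : ℂ) := by
    simpa using (hasDerivAt_id (ω₀ : ℂ)).const_mul Complex.I
  have hG : HasDerivAt (fun ω : ℝ => freqResp g ω / freqResp g ω₀)
      (deriv (value g) s₀ * Complex.I / freqResp g ω₀) ω₀ :=
    (HasDerivAt.comp (h := fun w : ℂ => Complex.I * w) _ hg hin).comp_ofReal.div_const _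
  have hlog : HasDerivAt (fun ω : ℝ => Complex.log (freqResp g ω / freqResp g ω₀))
      (deriv (value g) s₀ * Complex.I / freqResp g ω₀) ω₀ := by
    have := hG.clog_real (by rw [div_self h0]; exact Complex.one_mem_slitPlane)
    rwa [div_self h0, div_one] at this
  have harg : HasDerivAt (fun ω : ℝ => (Complex.log (freqResp g ω / freqResp g ω₀)).im)
      (deriv (value g) s₀ * Complex.I / freqResp g ω₀).im ω₀ :=
    Complex.imCLM.hasFDerivAt.comp_hasDerivAt _ hlog
  have hcont := hθ.self_of_nhds.1
  have hne : ∀ᶠ ω in 𝓝 ω₀, freqResp g ω ≠ 0 :=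
    (continuousAt_freqResp g ω₀ hp).eventually_ne h0
  have hclose : ∀ᶠ ω in 𝓝 ω₀, |θ ω - θ ω₀| < Real.pi :=
    (hcont.sub_const (θ ω₀)).abs.eventually_lt continuousAt_const (by simpa using Real.pi_pos)
  have heq : θ =ᶠ[𝓝 ω₀]
      fun ω => θ ω₀ + (Complex.log (freqResp g ω / freqResp g ω₀)).im := by
    filter_upwards [hθ, hne, hclose] with ω h1 h2 h3
    have e : freqResp g ω / freqResp g ω₀ = ((‖freqResp g ω‖ / ‖freqResp g ω₀‖ : ℝ) : ℂ) *
        (Complex.cos ((θ ω - θ ω₀ : ℝ) : ℂ) + Complex.sin ((θ ω - θ ω₀ : ℝ) : ℂ) * Complex.I) := by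
      rw [← Complex.exp_mul_I]
      conv_lhs => rw [h1.2, hθ.self_of_nhds.2]
      push_cast
      rw [sub_mul, Complex.exp_sub]
      field_simp
    rw [Complex.log_im, e, Complex.arg_mul_cos_add_sin_mul_I]
    · ring
    · exact div_pos (norm_pos_iff.2 h2) (norm_pos_iff.2 h0)
    · exact ⟨(abs_lt.1 h3).1, (abs_lt.1 h3).2.le⟩
  rw [((harg.const_add (θ ω₀)).congr_of_eventuallyEq heq).deriv]
  have e2 : value g s₀ = freqResp g ω₀ := rfl
  rw [e2, mul_div_right_comm]
  simp

lemma freqResp_eq_of_isPhaseNear {ω₀ : ℝ} {θ : ℝ → ℝ} (hθ : IsPhaseNear g ω₀ θ) :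
    freqResp g ω₀ = (‖freqResp g ω₀‖ : ℂ) * (Real.cos (θ ω₀) + Real.sin (θ ω₀) * Complex.I) := by
  conv_lhs => rw [hθ.self_of_nhds.2]
  rw [Complex.exp_mul_I]
  push_cast
  rfl

end Values

/-! ### The norm on the right half plane -/

section HInfNorm

variable {f : RatFunc ℝ}

/-- A stable `f` is bounded on the right half plane, so that its `hInfNorm` is a genuine supremum. -/
lemma exists_norm_value_le (hf : IsRHInf f) : ∃ M : ℝ, ∀ s : ℂ, 0 ≤ s.re → ‖value f s‖ ≤ M := by
  have hdeg : (f.num.map (algebraMap ℝ ℂ)).degree ≤ (f.denom.map (algebraMap ℝ ℂ)).degree := by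
    rw [degree_map, degree_map]
    exact hf.1
  obtain ⟨c, hc⟩ := (isBigO_cobounded_of_degree_le hdeg).bound
  obtain ⟨R, hR⟩ := (Bornology.isBounded_compl_iff.2 hc).exists_norm_le
  have hK : IsCompact (Metric.closedBall (0 : ℂ) R ∩ {s : ℂ | 0 ≤ s.re}) :=
    (isCompact_closedBall _ _).inter_right (isClosed_le continuous_const Complex.continuous_re)
  have hcont : ContinuousOn (value f) (Metric.closedBall (0 : ℂ) R ∩ {s : ℂ | 0 ≤ s.re}) :=
    fun s hs => (differentiableAt_value fun hp =>
      (hf.2 s hp).not_ge hs.2).continuousAt.continuousWithinAt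
  obtain ⟨M, hM⟩ := hK.exists_bound_of_continuousOn hcont
  refine ⟨max M c, fun s hs => ?_⟩
  by_cases h : ‖(f.num.map (algebraMap ℝ ℂ)).eval s‖ ≤ c * ‖(f.denom.map (algebraMap ℝ ℂ)).eval s‖
  · refine le_max_of_le_right ?_
    have hp : ¬ IsPole f s := fun hp => (hf.2 s hp).not_ge hs
    rw [value_eq_aeval_div, norm_div, div_le_iff₀ (norm_pos_iff.2 hp)]
    simpa [eval_map_algebraMap] using h
  · exact le_max_of_le_left (hM s ⟨mem_closedBall_zero_iff.2 (hR s h), hs⟩)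

lemma norm_value_le_hInfNorm_of_pos (hf : IsRHInf f) {s : ℂ} (hs : 0 < s.re) :
    ‖value f s‖ ≤ hInfNorm f := by
  obtain ⟨M, hM⟩ := exists_norm_value_le hf
  exact le_ciSup (f := fun s : {s : ℂ // 0 < s.re} => ‖value f s.1‖)
    ⟨M, by rintro _ ⟨s, rfl⟩; exact hM _ s.2.le⟩ ⟨s, hs⟩

lemma tendsto_value_add {s : ℂ} (hp : ¬ IsPole f s) :
    Tendsto (fun ε : ℝ => value f (s + ε)) (𝓝[>] 0) (𝓝 (value f s)) := by
  have h2 : Tendsto (fun ε : ℝ => s + (ε : ℂ)) (𝓝[>] 0) (𝓝 s) := by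
    have : Continuous fun ε : ℝ => s + (ε : ℂ) := by fun_prop
    simpa using (this.tendsto 0).mono_left nhdsWithin_le_nhds
  exact (differentiableAt_value hp).continuousAt.tendsto.comp h2

lemma norm_value_le_hInfNorm (hf : IsRHInf f) {s : ℂ} (hs : 0 ≤ s.re) :
    ‖value f s‖ ≤ hInfNorm f := by
  refine le_of_tendsto (tendsto_value_add fun hp => (hf.2 s hp).not_ge hs).norm ?_
  filter_upwards [self_mem_nhdsWithin] with ε (hε : 0 < ε)
  exact norm_value_le_hInfNorm_of_pos hf (by simpa using add_pos_of_nonneg_of_pos hs hε)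

/-- A bound attained on the closed half plane, possibly on its boundary, is the norm. -/
lemma hInfNorm_eq_of_le (hf : IsRHInf f) {c : ℝ} (hle : ∀ s : ℂ, 0 < s.re → ‖value f s‖ ≤ c)
    {s₀ : ℂ} (hs₀ : 0 ≤ s₀.re) (h : ‖value f s₀‖ = c) : hInfNorm f = c := by
  have : Nonempty {s : ℂ // 0 < s.re} := ⟨⟨1, by simp⟩⟩
  exact le_antisymm (ciSup_le fun s => hle _ s.2) (h ▸ norm_value_le_hInfNorm hf hs₀)

end HInfNorm

/-! ### Quotients of polynomials -/

section Quotients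

variable {f : RatFunc ℝ} {p q : ℝ[X]}

lemma num_mul_eq (hq : q ≠ 0) (hf : f = algebraMap _ (RatFunc ℝ) p / algebraMap _ (RatFunc ℝ) q) :
    f.num * q = p * f.denom := (RatFunc.num_mul_eq_mul_denom_iff hq).2 hf

lemma aeval_eq_zero_of_isPole (hf : f = algebraMap _ (RatFunc ℝ) p / algebraMap _ (RatFunc ℝ) q)
    {s : ℂ} (hs : IsPole f s) : aeval s q = 0 := by
  have : f.denom ∣ q := hf ▸ RatFunc.denom_div_dvd p q
  exact aeval_eq_zero_of_dvd_aeval_eq_zero this hs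

lemma value_eq_div (hq : q ≠ 0)
    (hf : f = algebraMap _ (RatFunc ℝ) p / algebraMap _ (RatFunc ℝ) q)
    {s : ℂ} (hs : aeval s q ≠ 0) : value f s = aeval s p / aeval s q := by
  have h1 : aeval s f.denom ≠ 0 := fun h => hs (aeval_eq_zero_of_isPole hf h)
  rw [value_eq_aeval_div, div_eq_div_iff h1 hs, ← map_mul, num_mul_eq hq hf, map_mul]

lemma isProper_of_eq_div (hq : q ≠ 0)
    (hf : f = algebraMap _ (RatFunc ℝ) p / algebraMap _ (RatFunc ℝ) q)
    (hdeg : p.degree ≤ q.degree) : IsProper f := by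
  have h := num_mul_eq hq hf
  rw [IsProper]
  by_cases h0 : f.num = 0
  · simp [h0]
  have hp : p ≠ 0 := fun hp => by
    rw [hp, zero_mul] at h
    exact mul_ne_zero h0 hq h
  have h1 := congrArg natDegree h
  rw [natDegree_mul h0 hq, natDegree_mul hp f.denom_ne_zero] at h1
  have h2 := natDegree_le_natDegree hdeg
  rw [degree_eq_natDegree h0, degree_eq_natDegree f.denom_ne_zero]
  exact_mod_cast (by omega : f.num.natDegree ≤ f.denom.natDegree)

lemma not_isZeroAt_and_isPole (h : RatFunc ℝ) (s : ℂ) : ¬ (IsZeroAt h s ∧ IsPole h s) := by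
  rintro ⟨h1, h2⟩
  obtain ⟨a, b, hab⟩ := h.isCoprime_num_denom
  have := congrArg (aeval s) hab
  rw [IsZeroAt] at h1
  rw [IsPole] at h2
  simp [h1, h2] at this

end Quotients

/-! ### The characteristic polynomial of the closed loop -/

section ClosedLoop

variable {f g : RatFunc ℝ}

/-- The product of the denominators of `f` and `g`, as a complex polynomial. -/
def loopDenom (f g : RatFunc ℝ) : ℂ[X] := (f.denom * g.denom).map (algebraMap ℝ ℂ)

/-- The product of the numerators of `f` and `g`, as a complex polynomial. Thus
`loopDenom f g - loopNum f g` is the characteristic polynomial of the closed loop, before any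
cancellation. -/
def loopNum (f g : RatFunc ℝ) : ℂ[X] := (f.num * g.num).map (algebraMap ℝ ℂ)

lemma eval_loopDenom (s : ℂ) :
    (loopDenom f g).eval s = aeval s f.denom * aeval s g.denom := by
  rw [loopDenom, eval_map_algebraMap, map_mul]

lemma eval_loopNum (s : ℂ) : (loopNum f g).eval s = aeval s f.num * aeval s g.num := by
  rw [loopNum, eval_map_algebraMap, map_mul]

lemma eval_loopNum_div (s : ℂ) :
    (loopNum f g).eval s / (loopDenom f g).eval s = value f s * value g s := by
  rw [eval_loopDenom, eval_loopNum, value_eq_aeval_div, value_eq_aeval_div, div_mul_div_comm]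

lemma eval_loopDenom_ne_zero {s : ℂ} (hf : ¬ IsPole f s) (hg : ¬ IsPole g s) :
    (loopDenom f g).eval s ≠ 0 := by
  rw [eval_loopDenom]
  exact mul_ne_zero hf hg

lemma monic_loopDenom : (loopDenom f g).Monic :=
  (f.monic_denom.mul g.monic_denom).map _

lemma degree_num_mul_lt (hf : IsProper f) (hg : IsStrictlyProper g) :
    (f.num * g.num).degree < (f.denom * g.denom).degree := by
  have hd : f.denom * g.denom ≠ 0 := mul_ne_zero f.denom_ne_zero g.denom_ne_zero
  by_cases h : f.num * g.num = 0
  · rw [h, degree_zero, bot_lt_iff_ne_bot, ne_eq, degree_eq_bot]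
    exact hd
  · have h1 := natDegree_le_natDegree hf
    have h2 := natDegree_lt_natDegree (right_ne_zero_of_mul h) hg
    rw [degree_eq_natDegree h, degree_eq_natDegree hd,
      natDegree_mul (left_ne_zero_of_mul h) (right_ne_zero_of_mul h),
      natDegree_mul f.denom_ne_zero g.denom_ne_zero]
    exact_mod_cast (by omega)

lemma degree_loopNum_lt (hf : IsProper f) (hg : IsStrictlyProper g) :
    (loopNum f g).degree < (loopDenom f g).degree := by
  rw [loopNum, loopDenom, degree_map, degree_map]
  exact degree_num_mul_lt hf hg

lemma isRoot_homotopy_conj (t : ℝ) (s : ℂ) (hs : (loopDenom f g - C (t : ℂ) * loopNum f g).IsRoot s) :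
    (loopDenom f g - C (t : ℂ) * loopNum f g).IsRoot (conj s) := by
  simp only [IsRoot.def, eval_sub, eval_mul, eval_C, eval_loopDenom, eval_loopNum] at hs ⊢
  have := congrArg conj hs
  simpa [aeval_conj] using this

/-- Since `f` is stable and `g` has no pole on the imaginary axis, the open right half plane contains
exactly the unstable poles of `g` among the roots of the product of the denominators. -/
lemma rhpCount_loopDenom (hf : ExponentiallyStable f) (hg : IsRLInf g) :
    rhpCount (loopDenom f g) = numUnstablePoles g := by
  have h0 : f.denom.map (algebraMap ℝ ℂ) * g.denom.map (algebraMap ℝ ℂ) ≠ 0 :=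
    mul_ne_zero ((f.monic_denom.map _).ne_zero) ((g.monic_denom.map _).ne_zero)
  rw [rhpCount, loopDenom, Polynomial.map_mul, roots_mul h0, Multiset.filter_add,
    Multiset.card_add, numUnstablePoles]
  have h1 : (f.denom.map (algebraMap ℝ ℂ)).roots.filter (fun s => 0 < s.re) = 0 := by
    refine Multiset.filter_eq_nil.2 fun s hs => ?_
    have : IsPole f s := by
      have := (mem_roots'.1 hs).2
      rwa [IsRoot.def, eval_map_algebraMap] at this
    exact (hf s this).not_gt
  rw [h1, Multiset.card_zero, zero_add, aroots]
  congr 1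
  refine Multiset.filter_congr fun s hs => ?_
  have hp : IsPole g s := by
    have := (mem_roots'.1 hs).2
    rwa [IsRoot.def, eval_map_algebraMap] at this
  exact ⟨le_of_lt, fun h => lt_of_le_of_ne h fun h' => not_isPole_of_re_eq_zero hg h'.symm hp⟩

lemma numUnstablePoles_ne_zero (hg : ¬ ExponentiallyStable g) : numUnstablePoles g ≠ 0 := by
  rw [ExponentiallyStable] at hg
  push Not at hg
  obtain ⟨s, hs, hre⟩ := hg
  have : s ∈ (g.denom.aroots ℂ).filter (fun s => 0 ≤ s.re) :=
    Multiset.mem_filter.2 ⟨mem_aroots.2 ⟨g.denom_ne_zero, hs⟩, hre⟩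
  rw [numUnstablePoles, ne_eq, Multiset.card_eq_zero]
  intro h
  simp [h] at this

lemma mul_eq_div (f g : RatFunc ℝ) : f * g = algebraMap ℝ[X] (RatFunc ℝ) (f.num * g.num) /
    algebraMap ℝ[X] (RatFunc ℝ) (f.denom * g.denom) := by
  conv_lhs => rw [← f.num_div_denom, ← g.num_div_denom]
  rw [div_mul_div_comm, map_mul, map_mul]

lemma denom_mul_sub_ne_zero (hf : IsProper f) (hg : IsStrictlyProper g) :
    f.denom * g.denom - f.num * g.num ≠ 0 := fun h => by
  have := degree_num_mul_lt hf hg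
  rw [sub_eq_zero.1 h] at this
  exact lt_irrefl _ this

lemma closedLoop_eq_div (f g : RatFunc ℝ) :
    1 / (1 - f * g) = algebraMap ℝ[X] (RatFunc ℝ) (f.denom * g.denom) /
      algebraMap ℝ[X] (RatFunc ℝ) (f.denom * g.denom - f.num * g.num) := by
  have hA : algebraMap ℝ[X] (RatFunc ℝ) (f.denom * g.denom) ≠ 0 :=
    RatFunc.algebraMap_ne_zero (mul_ne_zero f.denom_ne_zero g.denom_ne_zero)
  rw [mul_eq_div, map_sub, one_sub_div hA, one_div_div]

lemma map_sub_eq_loop : (f.denom * g.denom - f.num * g.num).map (algebraMap ℝ ℂ) =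
    loopDenom f g - loopNum f g := by
  rw [Polynomial.map_sub, loopDenom, loopNum]

/-- Where `loopDenom` and `loopNum` do not vanish together, the order of a pole of
the closed loop is its multiplicity as a root of the characteristic polynomial. -/
lemma poleOrder_closedLoop (hf : IsProper f) (hg : IsStrictlyProper g) {s : ℂ}
    (hs : ¬ ((loopDenom f g).eval s = 0 ∧ (loopNum f g).eval s = 0)) :
    poleOrder (1 / (1 - f * g)) s = (loopDenom f g - loopNum f g).rootMultiplicity s := by
  set h := 1 / (1 - f * g) with hh
  have hq := denom_mul_sub_ne_zero hf hg
  have hmul := num_mul_eq hq (closedLoop_eq_div f g)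
  rw [← hh] at hmul
  have hA : f.denom * g.denom ≠ 0 := mul_ne_zero f.denom_ne_zero g.denom_ne_zero
  have hmulC := congrArg (Polynomial.map (algebraMap ℝ ℂ)) hmul
  rw [Polynomial.map_mul, Polynomial.map_mul (p := f.denom * g.denom), map_sub_eq_loop,
    ← loopDenom] at hmulC
  have hD : h.denom.map (algebraMap ℝ ℂ) ≠ 0 := (h.monic_denom.map _).ne_zero
  have hAD : loopDenom f g * h.denom.map (algebraMap ℝ ℂ) ≠ 0 :=
    mul_ne_zero monic_loopDenom.ne_zero hD
  have hNX : h.num.map (algebraMap ℝ ℂ) * (loopDenom f g - loopNum f g) ≠ 0 := hmulC ▸ hAD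
  have hm := congrArg (rootMultiplicity s) hmulC
  rw [rootMultiplicity_mul hNX, rootMultiplicity_mul hAD] at hm
  have hN0 := left_ne_zero_of_mul hNX
  have hX0 := right_ne_zero_of_mul hNX
  have hcop : ¬ (0 < (h.num.map (algebraMap ℝ ℂ)).rootMultiplicity s ∧
      0 < (h.denom.map (algebraMap ℝ ℂ)).rootMultiplicity s) := by
    rintro ⟨h1, h2⟩
    have h1' := (rootMultiplicity_pos hN0).1 h1
    have h2' := (rootMultiplicity_pos hD).1 h2
    rw [IsRoot.def, eval_map_algebraMap] at h1' h2'
    exact not_isZeroAt_and_isPole h s ⟨h1', h2'⟩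
  have hsep : ¬ (0 < (loopDenom f g).rootMultiplicity s ∧
      0 < (loopDenom f g - loopNum f g).rootMultiplicity s) := by
    rintro ⟨h1, h2⟩
    have h1' : (loopDenom f g).eval s = 0 := (rootMultiplicity_pos monic_loopDenom.ne_zero).1 h1
    have h2' : (loopDenom f g).eval s - (loopNum f g).eval s = 0 := by
      simpa using (rootMultiplicity_pos hX0).1 h2
    exact hs ⟨h1', by rw [h1'] at h2'; linear_combination -h2'⟩
  rw [poleOrder]
  omega

lemma isPole_iff_poleOrder_pos {h : RatFunc ℝ} {s : ℂ} : IsPole h s ↔ 0 < poleOrder h s := by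
  rw [poleOrder, rootMultiplicity_pos (h.monic_denom.map _).ne_zero, IsRoot.def,
    eval_map_algebraMap, IsPole]

lemma not_common_root_of_noUnstableCancellation (hf : ExponentiallyStable f)
    (hc : NoUnstableCancellation f g) {s : ℂ} (hs : 0 ≤ s.re) :
    ¬ ((loopDenom f g).eval s = 0 ∧ (loopNum f g).eval s = 0) := by
  rintro ⟨h1, h2⟩
  rw [eval_loopDenom] at h1
  rw [eval_loopNum] at h2
  have hfp : ¬ IsPole f s := fun h => (hf s h).not_ge hs
  have hgp : IsPole g s := (mul_eq_zero.1 h1).resolve_left hfp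
  have hgz : ¬ IsZeroAt g s := fun h => not_isZeroAt_and_isPole g s ⟨h, hgp⟩
  exact (hc s hs).1 ⟨(mul_eq_zero.1 h2).resolve_right hgz, hgp⟩

/-- Without unstable cancellations, the unstable poles of the closed loop are the roots of the
characteristic polynomial in the closed right half plane. -/
lemma isRoot_of_marginallyStabilizes (hf : IsRHInf f) (hg : IsStrictlyProper g)
    (hfg : MarginallyStabilizes f g) (s : ℂ) (hs : 0 ≤ s.re)
    (hr : (loopDenom f g - loopNum f g).IsRoot s) :
    s.re = 0 ∧ (loopDenom f g - loopNum f g).rootMultiplicity s = 1 := by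
  have ho := poleOrder_closedLoop hf.1 hg
    (not_common_root_of_noUnstableCancellation hf.2 hfg.1 hs)
  have hp : IsPole (1 / (1 - f * g)) s := by
    rw [isPole_iff_poleOrder_pos, ho]
    exact (rootMultiplicity_pos (sub_ne_zero_of_degree_lt (degree_loopNum_lt hf.1 hg))).2 hr
  have h0 : s.re = 0 := by
    by_contra hne
    exact hfg.2.2.2.1 ⟨s, hp, lt_of_le_of_ne hs (Ne.symm hne)⟩
  exact ⟨h0, ho ▸ hfg.2.2.2.2 s hp h0⟩

/-- An unstable cancellation would be a root of the characteristic polynomial, hence on the imaginary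
axis, where `g` has no pole; so its absence need not be assumed. -/
lemma marginallyStabilizes_of_simple_roots (hf : IsRHInf f) (hg : IsStrictlyProper g)
    (hgi : IsRLInf g) (hroot : ∀ s : ℂ, 0 ≤ s.re → (loopDenom f g - loopNum f g).IsRoot s →
      s.re = 0 ∧ (loopDenom f g - loopNum f g).rootMultiplicity s = 1)
    {s₀ : ℂ} (hs₀ : s₀.re = 0) (hr₀ : (loopDenom f g - loopNum f g).IsRoot s₀) :
    MarginallyStabilizes f g := by
  have hne := sub_ne_zero_of_degree_lt (degree_loopNum_lt hf.1 hg)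
  have hfp : ∀ s : ℂ, 0 ≤ s.re → ¬ IsPole f s := fun s hs h => (hf.2 s h).not_ge hs
  have hcanc : NoUnstableCancellation f g := fun s hs => by
    refine ⟨fun h => ?_, fun h => hfp s hs h.2⟩
    have hD : aeval s g.denom = 0 := h.2
    have hP : aeval s f.num = 0 := h.1
    have hr : (loopDenom f g - loopNum f g).IsRoot s := by
      simp [IsRoot.def, eval_loopDenom, eval_loopNum, hD, hP]
    exact not_isPole_of_re_eq_zero hgi (hroot s hs hr).1 h.2
  have ho : ∀ s : ℂ, 0 ≤ s.re → poleOrder (1 / (1 - f * g)) s =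
      (loopDenom f g - loopNum f g).rootMultiplicity s := fun s hs =>
    poleOrder_closedLoop hf.1 hg (not_common_root_of_noUnstableCancellation hf.2 hcanc hs)
  have hpole : ∀ s : ℂ, 0 ≤ s.re → (IsPole (1 / (1 - f * g)) s ↔
      (loopDenom f g - loopNum f g).IsRoot s) := fun s hs => by
    rw [isPole_iff_poleOrder_pos, ho s hs, rootMultiplicity_pos hne]
  refine ⟨hcanc, ?_, fun h => ?_, ?_, fun s hs hre => ?_⟩
  · refine isProper_of_eq_div (denom_mul_sub_ne_zero hf.1 hg) (closedLoop_eq_div f g) ?_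
    rw [degree_sub_eq_left_of_degree_lt (degree_num_mul_lt hf.1 hg)]
  · exact (h s₀ ((hpole s₀ hs₀.ge).2 hr₀)).ne hs₀
  · rintro ⟨s, hs, hre⟩
    exact hre.ne' (hroot s hre.le ((hpole s hre.le).1 hs)).1
  · rw [ho s hre.ge]
    exact (hroot s hre.ge ((hpole s hre.ge).1 hs)).2

end ClosedLoop

/-! ### Marginal stabilization in terms of crossings -/

section Criterion

variable {f g : RatFunc ℝ} {n : ℕ} {ω₀ : ℝ}

/-- Where `f g = 1`, the derivative of `f g` is the sum of the logarithmic derivatives. -/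
lemma deriv_loop {s : ℂ} (hf : ¬ IsPole f s) (hg : ¬ IsPole g s)
    (h1 : value f s * value g s = 1) :
    deriv (fun s => (loopNum f g).eval s / (loopDenom f g).eval s) s =
      deriv (value f) s / value f s + deriv (value g) s / value g s := by
  have e : (fun s => (loopNum f g).eval s / (loopDenom f g).eval s) =
      fun s => value f s * value g s := funext eval_loopNum_div
  have hf0 := left_ne_zero_of_mul_eq_one h1
  have hg0 := right_ne_zero_of_mul_eq_one h1
  rw [e, deriv_fun_mul (differentiableAt_value hf) (differentiableAt_value hg),
    div_add_div _ _ hf0 hg0, h1, div_one]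

lemma isRoot_loop_iff {s : ℂ} (hf : ¬ IsPole f s) (hg : ¬ IsPole g s) :
    (loopDenom f g - loopNum f g).IsRoot s ↔ value f s * value g s = 1 := by
  rw [← eval_loopNum_div, div_eq_one_iff_eq (eval_loopDenom_ne_zero hf hg), IsRoot.def, eval_sub,
    sub_eq_zero, eq_comm]

lemma norm_loopNum_le_iff {s : ℂ} (hf : ¬ IsPole f s) (hg : ¬ IsPole g s) :
    ‖(loopNum f g).eval s‖ ≤ ‖(loopDenom f g).eval s‖ ↔ ‖value f s‖ * ‖value g s‖ ≤ 1 := by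
  rw [← norm_mul, ← eval_loopNum_div, norm_div,
    div_le_one (norm_pos_iff.2 (eval_loopDenom_ne_zero hf hg))]

lemma norm_loopNum_lt_iff {s : ℂ} (hf : ¬ IsPole f s) (hg : ¬ IsPole g s) :
    ‖(loopNum f g).eval s‖ < ‖(loopDenom f g).eval s‖ ↔ ‖value f s‖ * ‖value g s‖ < 1 := by
  rw [← norm_mul, ← eval_loopNum_div, norm_div,
    div_lt_one (norm_pos_iff.2 (eval_loopDenom_ne_zero hf hg))]

lemma not_isPole_of_isRHInf (hf : IsRHInf f) {s : ℂ} (hs : 0 ≤ s.re) : ¬ IsPole f s :=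
  fun h => (hf.2 s h).not_ge hs

/-- The small gain bound on the imaginary axis. -/
lemma norm_value_mul_le_one (hmax : ∀ ω, ‖freqResp g ω‖ ≤ ‖freqResp g ω₀‖)
    (h0 : freqResp g ω₀ ≠ 0) (hf : IsRHInf f) (hnorm : hInfNorm f = 1 / ‖freqResp g ω₀‖) {s : ℂ}
    (hs : s.re = 0) : ‖value f s‖ * ‖value g s‖ ≤ 1 := by
  have h1 := norm_value_le_hInfNorm hf hs.ge
  rw [hnorm] at h1
  rw [value_of_re_eq_zero g hs]
  calc _ ≤ 1 / ‖freqResp g ω₀‖ * ‖freqResp g ω₀‖ :=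
        mul_le_mul h1 (hmax _) (norm_nonneg _) (by positivity)
    _ = 1 := one_div_mul_cancel (norm_ne_zero_iff.2 h0)

/-- A marginally stabilizing `f` of minimal norm makes exactly `n` unstable poles arrive at peak
frequencies, and there the total phase of the loop has a positive derivative. -/
theorem exists_crossings_of_marginallyStabilizes (hg : ClassG n g)
    (hmax : ∀ ω, ‖freqResp g ω‖ ≤ ‖freqResp g ω₀‖) (h0 : freqResp g ω₀ ≠ 0) (hf : IsRHInf f)
    (hnorm : hInfNorm f = 1 / ‖freqResp g ω₀‖) (hfg : MarginallyStabilizes f g) :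
    ∃ Z : Finset ℂ, Z.card = n ∧
      (∀ s ∈ Z, s.re = 0 ∧ value f s * value g s = 1 ∧ ‖freqResp g s.im‖ = ‖freqResp g ω₀‖ ∧
        0 < (deriv (value f) s / value f s + deriv (value g) s / value g s).re) ∧
      (Z.card = 1 → ∀ s ∈ Z, s = 0) := by
  have hfp : ∀ s : ℂ, s.re = 0 → ¬ IsPole f s := fun s hs => not_isPole_of_isRHInf hf hs.ge
  have hgp : ∀ s : ℂ, s.re = 0 → ¬ IsPole g s := fun s hs =>
    not_isPole_of_re_eq_zero hg.isRLInf hs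
  obtain ⟨Z, hcard, hZ, hone⟩ := exists_crossings monic_loopDenom
    (degree_loopNum_lt hf.1 hg.strictlyProper)
    (fun s hs => eval_loopDenom_ne_zero (hfp s hs) (hgp s hs))
    (fun s hs => (norm_loopNum_le_iff (hfp s hs) (hgp s hs)).2
      (norm_value_mul_le_one hmax h0 hf hnorm hs))
    (isRoot_of_marginallyStabilizes hf hg.strictlyProper hfg) isRoot_homotopy_conj
  refine ⟨Z, ?_, fun s hs => ?_, hone⟩
  · rw [hcard, rhpCount_loopDenom hf.2 hg.isRLInf, hg.numUnstablePoles_eq]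
  · obtain ⟨hre, hr, hpos⟩ := hZ s hs
    have h1 := (isRoot_loop_iff (hfp s hre) (hgp s hre)).1 hr
    rw [deriv_loop (hfp s hre) (hgp s hre) h1] at hpos
    refine ⟨hre, h1, le_antisymm (hmax _) ?_, hpos⟩
    have h2 := norm_value_le_hInfNorm hf hre.ge
    have h3 : ‖value f s‖ * ‖value g s‖ = 1 := by rw [← norm_mul, h1, norm_one]
    rw [hnorm] at h2
    rw [← value_of_re_eq_zero g hre]
    have h4 : 0 < ‖freqResp g ω₀‖ := norm_pos_iff.2 h0
    rw [le_div_iff₀ h4] at h2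
    -- at an axis point that is not a peak, the small gain bound would be strict
    by_contra! hlt
    have h5 : 0 < ‖value f s‖ := norm_pos_iff.2 (left_ne_zero_of_mul_eq_one h1)
    nlinarith

/-- Conversely, `f` marginally stabilizes `g` if the frequencies at which the small gain bound is
attained are `n` in number and at each of them the loop equals `1`, with an increasing phase. -/
theorem marginallyStabilizes_of_crossings (hg : ClassG n g)
    (hmax : ∀ ω, ‖freqResp g ω‖ ≤ ‖freqResp g ω₀‖) (h0 : freqResp g ω₀ ≠ 0) (hf : IsRHInf f)
    (hnorm : hInfNorm f = 1 / ‖freqResp g ω₀‖) {Z : Finset ℂ} (hcard : Z.card = n)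
    (hlt : ∀ s : ℂ, s.re = 0 → s ∉ Z → ‖freqResp g s.im‖ < ‖freqResp g ω₀‖)
    (hZ : ∀ s ∈ Z, s.re = 0 ∧ value f s * value g s = 1 ∧
      0 < (deriv (value f) s / value f s + deriv (value g) s / value g s).re) :
    MarginallyStabilizes f g := by
  have hfp : ∀ s : ℂ, s.re = 0 → ¬ IsPole f s := fun s hs => not_isPole_of_isRHInf hf hs.ge
  have hgp : ∀ s : ℂ, s.re = 0 → ¬ IsPole g s := fun s hs =>
    not_isPole_of_re_eq_zero hg.isRLInf hs
  have hn : Z.card ≠ 0 := by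
    rw [hcard, ← hg.numUnstablePoles_eq]
    exact numUnstablePoles_ne_zero hg.unstable
  obtain ⟨s₀, hs₀⟩ := Finset.card_ne_zero.1 hn
  refine marginallyStabilizes_of_simple_roots hf hg.strictlyProper hg.isRLInf ?_ (hZ s₀ hs₀).1
    ((isRoot_loop_iff (hfp _ (hZ s₀ hs₀).1) (hgp _ (hZ s₀ hs₀).1)).2 (hZ s₀ hs₀).2.1)
  refine simple_roots_of_crossings monic_loopDenom (degree_loopNum_lt hf.1 hg.strictlyProper)
    (fun s hs => eval_loopDenom_ne_zero (hfp s hs) (hgp s hs))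
    (fun s hs => (norm_loopNum_le_iff (hfp s hs) (hgp s hs)).2
      (norm_value_mul_le_one hmax h0 hf hnorm hs)) (Z := Z)
    ?_ (fun s hs hsZ => (norm_loopNum_lt_iff (hfp s hs) (hgp s hs)).2 ?_) (fun s hs => ?_)
  · rw [hcard, rhpCount_loopDenom hf.2 hg.isRLInf, hg.numUnstablePoles_eq]
  · have h1 := norm_value_le_hInfNorm hf hs.ge
    rw [hnorm, le_div_iff₀ (norm_pos_iff.2 h0)] at h1
    rw [value_of_re_eq_zero g hs]
    have h2 := hlt s hs hsZ
    rcases (norm_nonneg (value f s)).eq_or_lt with h3 | h3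
    · rw [← h3, zero_mul]; exact one_pos
    · nlinarith
  · obtain ⟨hre, h1, hpos⟩ := hZ s hs
    refine ⟨hre, (isRoot_loop_iff (hfp s hre) (hgp s hre)).2 h1, ?_⟩
    rwa [deriv_loop (hfp s hre) (hgp s hre) h1]

/-- At a peak, the phase of a stable `f` of norm `1 / |g|` that inverts `g` there decreases, at least
at the rate prescribed by the Schwarz-Pick inequality. -/
theorem abs_sin_le_of_value_mul_eq_one {θ : ℝ → ℝ} (hθ : IsPhaseNear g ω₀ θ)
    (h0 : freqResp g ω₀ ≠ 0) (hf : IsRHInf f) (hnorm : hInfNorm f = 1 / ‖freqResp g ω₀‖)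
    (h1 : value f (Complex.I * ω₀) * value g (Complex.I * ω₀) = 1) :
    |Real.sin (θ ω₀)| ≤
        -(deriv (value f) (Complex.I * ω₀) / value f (Complex.I * ω₀)).re * |ω₀| ∧
      (deriv (value f) (Complex.I * ω₀) / value f (Complex.I * ω₀)).re ≤ 0 := by
  set s₀ : ℂ := Complex.I * ω₀ with hs₀
  set c : ℝ := ‖freqResp g ω₀‖ with hc
  have hcpos : 0 < c := norm_pos_iff.2 h0
  have hre : s₀.re = 0 := by simp [hs₀]
  have him : s₀.im = ω₀ := by simp [hs₀]
  have hfp : ∀ s : ℂ, 0 ≤ s.re → ¬ IsPole f s := fun s hs => not_isPole_of_isRHInf hf hs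
  have hFle : ∀ s : ℂ, 0 < s.re → ‖(c : ℂ) * value f s‖ ≤ 1 := fun s hs => by
    have h := norm_value_le_hInfNorm hf hs.le
    rw [hnorm, le_div_iff₀ hcpos] at h
    rw [norm_mul, Complex.norm_real, Real.norm_of_nonneg hcpos.le]
    linarith
  have hFconj : ∀ s, (c : ℂ) * value f (conj s) = conj ((c : ℂ) * value f s) := fun s => by
    rw [map_mul, Complex.conj_ofReal, value_conj]
  have hFd : HasDerivAt (fun s => (c : ℂ) * value f s) ((c : ℂ) * deriv (value f) s₀) s₀ :=
    (differentiableAt_value (hfp s₀ hre.ge)).hasDerivAt.const_mul _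
  have hFdiff : DifferentiableOn ℂ (fun s => (c : ℂ) * value f s) {s | 0 < s.re} := fun s hs =>
    ((differentiableAt_value (hfp s (le_of_lt hs))).const_mul _).differentiableWithinAt
  have hFs : (c : ℂ) * value f s₀ = Real.cos (θ ω₀) - Real.sin (θ ω₀) * Complex.I := by
    have h2 : value g s₀ = c * (Real.cos (θ ω₀) + Real.sin (θ ω₀) * Complex.I) :=
      freqResp_eq_of_isPhaseNear hθ
    have h3 : (Real.cos (θ ω₀) : ℂ) ^ 2 + (Real.sin (θ ω₀) : ℂ) ^ 2 = 1 := by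
      exact_mod_cast Real.cos_sq_add_sin_sq (θ ω₀)
    rw [h2] at h1
    linear_combination (Real.cos (θ ω₀) - Real.sin (θ ω₀) * Complex.I) * h1 -
      c * value f s₀ * h3 + c * value f s₀ * (Real.sin (θ ω₀)) ^ 2 * Complex.I_sq
  have hprod : ((c : ℂ) * value f s₀) * conj ((c : ℂ) * value f s₀) = 1 := by
    have h3 : (Real.cos (θ ω₀) : ℂ) ^ 2 + (Real.sin (θ ω₀) : ℂ) ^ 2 = 1 := by
      exact_mod_cast Real.cos_sq_add_sin_sq (θ ω₀)
    rw [hFs, map_sub, map_mul, Complex.conj_ofReal, Complex.conj_ofReal, Complex.conj_I]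
    linear_combination h3 - (Real.sin (θ ω₀) : ℂ) ^ 2 * Complex.I_sq
  have hnormF : ‖(c : ℂ) * value f s₀‖ = 1 := by
    rw [Complex.mul_conj, Complex.normSq_eq_norm_sq] at hprod
    have : ‖(c : ℂ) * value f s₀‖ ^ 2 = 1 := by exact_mod_cast hprod
    exact (pow_eq_one_iff_of_nonneg (norm_nonneg _) two_ne_zero).1 this
  have hlog : ((c : ℂ) * deriv (value f) s₀) * conj ((c : ℂ) * value f s₀) =
      deriv (value f) s₀ / value f s₀ := by
    rw [eq_div_iff (left_ne_zero_of_mul_eq_one h1)]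
    linear_combination deriv (value f) s₀ * hprod
  have hmain := abs_im_le_neg_re_deriv_mul hFdiff hFle hFconj hre hFd hnormF
  have hneg := re_deriv_mul_conj_nonpos hFle hre hFd hnormF
  rw [hlog] at hmain hneg
  refine ⟨?_, hneg⟩
  rw [hFs, him] at hmain
  simpa [-Complex.ofReal_sin, -Complex.ofReal_cos] using hmain

end Criterion

/-! ### Constant and first-order all-pass controllers -/

section Controllers

variable {g : RatFunc ℝ} {n : ℕ} {ω₀ : ℝ}

lemma value_C (c : ℝ) (s : ℂ) : value (RatFunc.C c) s = c := by
  simp [value]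

lemma isRHInf_C (c : ℝ) : IsRHInf (RatFunc.C c) := by
  refine ⟨?_, fun s hs => ?_⟩
  · rw [IsProper, RatFunc.num_C, RatFunc.denom_C, degree_one]
    exact degree_C_le
  · rw [IsPole, RatFunc.denom_C] at hs
    simp at hs

lemma hInfNorm_C (c : ℝ) : hInfNorm (RatFunc.C c) = |c| :=
  hInfNorm_eq_of_le (isRHInf_C c) (fun s _ => by simp [value_C]) (s₀ := 0) le_rfl
    (by simp [value_C])

lemma allPass_eq_div (k a : ℝ) :
    RatFunc.C k * ((RatFunc.C a - RatFunc.X) / (RatFunc.C a + RatFunc.X)) =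
      algebraMap ℝ[X] (RatFunc ℝ) (C k * (C a - X)) / algebraMap ℝ[X] (RatFunc ℝ) (C a + X) := by
  simp [mul_div_assoc]

lemma C_add_X_ne_zero (a : ℝ) : (C a + X : ℝ[X]) ≠ 0 := by
  rw [add_comm]
  exact X_add_C_ne_zero a

lemma value_allPass (k : ℝ) {a : ℝ} {s : ℂ} (hs : (a : ℂ) + s ≠ 0) :
    value (RatFunc.C k * ((RatFunc.C a - RatFunc.X) / (RatFunc.C a + RatFunc.X))) s =
      k * (a - s) / (a + s) := by
  rw [value_eq_div (C_add_X_ne_zero a) (allPass_eq_div k a) (by simpa using hs)]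
  simp

lemma add_ne_zero_of_re_nonneg {a : ℝ} (ha : 0 < a) {s : ℂ} (hs : 0 ≤ s.re) :
    (a : ℂ) + s ≠ 0 := fun h => by
  have := congrArg Complex.re h
  simp at this
  linarith

lemma isRHInf_allPass (k : ℝ) {a : ℝ} (ha : 0 < a) :
    IsRHInf (RatFunc.C k * ((RatFunc.C a - RatFunc.X) / (RatFunc.C a + RatFunc.X))) := by
  refine ⟨isProper_of_eq_div (C_add_X_ne_zero a) (allPass_eq_div k a) ?_, fun s hs => ?_⟩
  · rw [add_comm (C a), degree_X_add_C, ← smul_eq_C_mul]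
    refine (degree_smul_le _ _).trans ?_
    rw [← neg_sub, degree_neg, degree_X_sub_C]
  · by_contra! hre
    have := aeval_eq_zero_of_isPole (allPass_eq_div k a) hs
    exact add_ne_zero_of_re_nonneg ha hre (by simpa using this)

lemma hInfNorm_allPass (k : ℝ) {a : ℝ} (ha : 0 < a) :
    hInfNorm (RatFunc.C k * ((RatFunc.C a - RatFunc.X) / (RatFunc.C a + RatFunc.X))) = |k| := by
  refine hInfNorm_eq_of_le (isRHInf_allPass k ha) (fun s hs => ?_) (s₀ := 0) le_rfl ?_
  · rw [value_allPass k (add_ne_zero_of_re_nonneg ha hs.le), mul_div_assoc, norm_mul,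
      Complex.norm_real, Real.norm_eq_abs, norm_div]
    refine mul_le_of_le_one_right (abs_nonneg k) (div_le_one_of_le₀ ?_ (norm_nonneg _))
    rw [← sq_le_sq₀ (norm_nonneg _) (norm_nonneg _), Complex.sq_norm, Complex.sq_norm,
      Complex.normSq_apply, Complex.normSq_apply]
    simp
    nlinarith [mul_pos ha hs]
  · have h : (a : ℂ) ≠ 0 := by exact_mod_cast ha.ne'
    rw [value_allPass k (add_ne_zero_of_re_nonneg ha le_rfl), sub_zero, add_zero,
      mul_div_cancel_right₀ _ h, Complex.norm_real, Real.norm_eq_abs]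

lemma logDeriv_allPass {k a : ℝ} (hk : k ≠ 0) (ha : 0 < a) (ω : ℝ) :
    deriv (value (RatFunc.C k * ((RatFunc.C a - RatFunc.X) / (RatFunc.C a + RatFunc.X))))
        (Complex.I * ω) /
      value (RatFunc.C k * ((RatFunc.C a - RatFunc.X) / (RatFunc.C a + RatFunc.X)))
        (Complex.I * ω) = ((-(2 * a / (a ^ 2 + ω ^ 2)) : ℝ) : ℂ) := by
  set s : ℂ := Complex.I * ω with hs
  have hre : s.re = 0 := by simp [hs]
  have hp : (a : ℂ) + s ≠ 0 := add_ne_zero_of_re_nonneg ha hre.ge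
  have hm : (a : ℂ) - s ≠ 0 := by
    have := add_ne_zero_of_re_nonneg ha (s := -s) (by simp [hre])
    rwa [← sub_eq_add_neg] at this
  have hev : value (RatFunc.C k * ((RatFunc.C a - RatFunc.X) / (RatFunc.C a + RatFunc.X)))
      =ᶠ[𝓝 s] fun s => k * (a - s) / (a + s) := by
    have : ContinuousAt (fun s : ℂ => (a : ℂ) + s) s := by fun_prop
    filter_upwards [this.eventually_ne hp] with w hw
    exact value_allPass k hw
  have h1 : HasDerivAt (fun s : ℂ => (k : ℂ) * (a - s)) (k * -1) s :=
    ((hasDerivAt_id s).const_sub (a : ℂ)).const_mul (k : ℂ)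
  have h2 : HasDerivAt (fun s : ℂ => (a : ℂ) + s) 1 s := (hasDerivAt_id s).const_add (a : ℂ)
  rw [hev.deriv_eq, (h1.fun_div h2 hp).deriv, value_allPass k hp]
  have hk' : (k : ℂ) ≠ 0 := by exact_mod_cast hk
  have e : ((a : ℂ) ^ 2 + (ω : ℂ) ^ 2) = (a + s) * (a - s) := by
    rw [hs]
    linear_combination (ω : ℂ) ^ 2 * Complex.I_sq
  push_cast
  rw [e]
  field_simp
  ring

lemma deriv_value_conj {h : RatFunc ℝ} {s : ℂ} (hs : ¬ IsPole h s) :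
    deriv (value h) (conj s) = conj (deriv (value h) s) := by
  have h1 := (differentiableAt_value hs).hasDerivAt.conj_conj
  have e : conj ∘ value h ∘ conj = value h := by
    funext z
    simp [value_conj]
  rw [e] at h1
  exact h1.deriv

/-- By conjugation symmetry, crossings come in conjugate pairs. -/
lemma crossing_conj {f : RatFunc ℝ} {s : ℂ} (hf : ¬ IsPole f s) (hg : ¬ IsPole g s)
    (h : s.re = 0 ∧ value f s * value g s = 1 ∧
      0 < (deriv (value f) s / value f s + deriv (value g) s / value g s).re) :
    (conj s).re = 0 ∧ value f (conj s) * value g (conj s) = 1 ∧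
      0 < (deriv (value f) (conj s) / value f (conj s) +
        deriv (value g) (conj s) / value g (conj s)).re := by
  rw [deriv_value_conj hf, deriv_value_conj hg, value_conj, value_conj, ← map_mul, h.2.1,
    ← map_div₀, ← map_div₀, ← map_add, Complex.conj_re, Complex.conj_re]
  exact ⟨h.1, map_one _, h.2.2⟩

/-- A constant inverts `g` at a frequency where its phase is a multiple of `π`. -/
lemma value_C_mul_eq_one {θ : ℝ → ℝ} (hθ : IsPhaseNear g ω₀ θ) (h0 : freqResp g ω₀ ≠ 0)
    (hsin : Real.sin (θ ω₀) = 0) :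
    value (RatFunc.C (Real.cos (θ ω₀) / ‖freqResp g ω₀‖)) (Complex.I * ω₀) *
      value g (Complex.I * ω₀) = 1 := by
  have h2 : value g (Complex.I * ω₀) =
      ‖freqResp g ω₀‖ * (Real.cos (θ ω₀) + Real.sin (θ ω₀) * Complex.I) :=
    freqResp_eq_of_isPhaseNear hθ
  have h3 : (Real.cos (θ ω₀) : ℂ) ^ 2 = 1 := by
    have := Real.cos_sq_add_sin_sq (θ ω₀)
    rw [hsin] at this
    exact_mod_cast (by linarith : Real.cos (θ ω₀) ^ 2 = 1)
  have hc : (‖freqResp g ω₀‖ : ℂ) ≠ 0 := by exact_mod_cast norm_ne_zero_iff.2 h0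
  rw [value_C, h2, hsin, Complex.ofReal_zero, zero_mul, add_zero, Complex.ofReal_div]
  field_simp
  exact h3

lemma hInfNorm_C_cos_div {θ : ℝ} {c : ℝ} (hc : 0 ≤ c) (hsin : Real.sin θ = 0) :
    hInfNorm (RatFunc.C (Real.cos θ / c)) = 1 / c := by
  have h1 : |Real.cos θ| = 1 := by
    rw [← Real.sqrt_sq_eq_abs, Real.cos_sq', hsin]
    simp
  rw [hInfNorm_C, abs_div, h1, abs_of_nonneg hc]

lemma logDeriv_C (c : ℝ) (s : ℂ) :
    deriv (value (RatFunc.C c)) s / value (RatFunc.C c) s = 0 := by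
  have : value (RatFunc.C c) = fun _ => (c : ℂ) := funext (value_C c)
  simp [this]

/-- The parameters of the all-pass function that inverts `g` at `ω`, where the phase of `g` is `θ`:
with `σ = ±1` the sign of `sin θ`, the zero `a` is `ω (1 + σ cos θ) / |sin θ|`. -/
lemma exists_allPass_parameters {ω θ : ℝ} (hω : 0 < ω) (hsin : Real.sin θ ≠ 0) :
    ∃ σ a : ℝ, |σ| = 1 ∧ 0 < a ∧ 2 * a / (a ^ 2 + ω ^ 2) = |Real.sin θ| / ω ∧
      σ * (a * Real.cos θ + ω * Real.sin θ) = a ∧ σ * (a * Real.sin θ - ω * Real.cos θ) = ω := by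
  obtain ⟨σ, hσ, hσs⟩ : ∃ σ : ℝ, |σ| = 1 ∧ σ * Real.sin θ = |Real.sin θ| := by
    rcases lt_or_gt_of_ne hsin with h | h
    · exact ⟨-1, by simp, by rw [abs_of_neg h]; ring⟩
    · exact ⟨1, by simp, by rw [abs_of_pos h]; ring⟩
  have hσ2 : σ ^ 2 = 1 := by rw [← sq_abs, hσ, one_pow]
  have hS : 0 < |Real.sin θ| := abs_pos.2 hsin
  have hS2 : |Real.sin θ| ^ 2 = 1 - Real.cos θ ^ 2 := by rw [sq_abs, Real.sin_sq]
  have hprod : (1 + σ * Real.cos θ) * (1 - σ * Real.cos θ) = |Real.sin θ| ^ 2 := by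
    rw [hS2]
    linear_combination -Real.cos θ ^ 2 * hσ2
  have hpos : 0 < 1 + σ * Real.cos θ := by
    by_contra! hle
    nlinarith [pow_pos hS 2]
  set a : ℝ := ω * (1 + σ * Real.cos θ) / |Real.sin θ| with ha
  have ha1 : a * |Real.sin θ| = ω * (1 + σ * Real.cos θ) := by
    rw [ha]; field_simp
  have ha2 : a * (1 - σ * Real.cos θ) = ω * |Real.sin θ| := by
    rw [ha, div_mul_eq_mul_div, mul_assoc, hprod]
    field_simp
  have ha0 : 0 < a := div_pos (mul_pos hω hpos) hS
  refine ⟨σ, a, hσ, ha0, ?_, ?_, ?_⟩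
  · rw [div_eq_div_iff (by positivity) hω.ne']
    linear_combination -a * ha1 + ω * ha2
  · linear_combination ω * hσs - ha2
  · linear_combination a * hσs + ha1

end Controllers
end TransferFunction

end

open TransferFunction ComplexConjugate

theorem mainTheorem1 :
    (∀ (n : ℕ) (g : RatFunc ℝ), ClassGZero n g →
      ∀ θ : ℝ → ℝ, IsPhaseNear g 0 θ →
        ((∃ f : RatFunc ℝ, IsRHInf f ∧ hInfNorm f = 1 / ‖freqResp g 0‖ ∧
            MarginallyStabilizes f g) ↔
          (n = 1 ∧ 0 < deriv θ 0)) ∧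
        ((n = 1 ∧ 0 < deriv θ 0) →
          ∃ f : RatFunc ℝ, (∃ c : ℝ, f = RatFunc.C c) ∧
            IsRHInf f ∧ hInfNorm f = 1 / ‖freqResp g 0‖ ∧ MarginallyStabilizes f g)) ∧
    (∀ (n : ℕ) (g : RatFunc ℝ) (ωp : ℝ), ClassGSharp n g ωp →
      ∀ θ : ℝ → ℝ, IsPhaseNear g ωp θ →
        ((∃ f : RatFunc ℝ, IsRHInf f ∧ hInfNorm f = 1 / ‖freqResp g ωp‖ ∧
            MarginallyStabilizes f g) ↔
          (n = 2 ∧ |Real.sin (θ ωp) / ωp| < deriv θ ωp)) ∧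
        ((n = 2 ∧ |Real.sin (θ ωp) / ωp| < deriv θ ωp) →
          ∃ f : RatFunc ℝ,
            ((Real.sin (θ ωp) = 0 ∧ ∃ c : ℝ, f = RatFunc.C c) ∨
              (Real.sin (θ ωp) ≠ 0 ∧ IsFirstOrderAllPass f)) ∧
            IsRHInf f ∧ hInfNorm f = 1 / ‖freqResp g ωp‖ ∧ MarginallyStabilizes f g)) := by
  constructor
  · intro n g hg θ hθ
    have h0 : freqResp g 0 ≠ 0 := norm_pos_iff.1 ((norm_nonneg _).trans_lt (hg.lt_peak 1 one_ne_zero))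
    have hmax : ∀ ω, ‖freqResp g ω‖ ≤ ‖freqResp g 0‖ := fun ω => by
      rcases eq_or_ne ω 0 with rfl | h
      · exact le_rfl
      · exact (hg.lt_peak ω h).le
    have hgp : ¬ IsPole g (Complex.I * ((0 : ℝ) : ℂ)) := hg.isRLInf.1 0
    have hderiv := deriv_phase hθ hgp h0
    have hnec : (∃ f : RatFunc ℝ, IsRHInf f ∧ hInfNorm f = 1 / ‖freqResp g 0‖ ∧
        MarginallyStabilizes f g) → (n = 1 ∧ 0 < deriv θ 0) := by
      rintro ⟨f, hf, hnorm, hfg⟩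
      obtain ⟨Z, hcard, hZ, -⟩ :=
        exists_crossings_of_marginallyStabilizes hg.toClassG hmax h0 hf hnorm hfg
      have hsub : ∀ s ∈ Z, s = Complex.I * ((0 : ℝ) : ℂ) := fun s hs => by
        rw [eq_I_mul_of_re_eq_zero (hZ s hs).1]
        by_contra hne
        refine (hg.lt_peak s.im fun him => hne (by rw [him])).ne (hZ s hs).2.2.1
      have hle : Z.card ≤ 1 := Finset.card_le_one.2 fun a ha b hb => by rw [hsub a ha, hsub b hb]
      have hn : n ≠ 0 := by
        rw [← hg.numUnstablePoles_eq]
        exact numUnstablePoles_ne_zero hg.unstable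
      obtain ⟨s, hs⟩ := Finset.card_ne_zero.1 (by rwa [hcard] : Z.card ≠ 0)
      obtain ⟨-, h1, -, hpos⟩ := hZ s hs
      rw [hsub s hs] at h1 hpos
      refine ⟨by omega, ?_⟩
      have := (abs_sin_le_of_value_mul_eq_one hθ h0 hf hnorm h1).2
      rw [Complex.add_re] at hpos
      rw [hderiv]
      linarith
    have hsuf : (n = 1 ∧ 0 < deriv θ 0) → ∃ f : RatFunc ℝ, (∃ c : ℝ, f = RatFunc.C c) ∧
        IsRHInf f ∧ hInfNorm f = 1 / ‖freqResp g 0‖ ∧ MarginallyStabilizes f g := by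
      rintro ⟨rfl, hpos⟩
      have hsin : Real.sin (θ 0) = 0 := by
        have him : (freqResp g 0).im = 0 := by
          have := freqResp_neg g 0
          rw [neg_zero] at this
          exact Complex.conj_eq_iff_im.1 this.symm
        rw [freqResp_eq_of_isPhaseNear hθ] at him
        simpa [h0, -Complex.ofReal_sin, -Complex.ofReal_cos] using him
      have hnorm := hInfNorm_C_cos_div (norm_nonneg (freqResp g 0)) hsin
      refine ⟨RatFunc.C (Real.cos (θ 0) / ‖freqResp g 0‖), ⟨_, rfl⟩, isRHInf_C _, hnorm, ?_⟩
      refine marginallyStabilizes_of_crossings hg.toClassG hmax h0 (isRHInf_C _) hnorm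
        (Z := {Complex.I * ((0 : ℝ) : ℂ)}) (Finset.card_singleton _) (fun s hs hsZ => ?_) ?_
      · refine hg.lt_peak _ fun him => hsZ ?_
        rw [Finset.mem_singleton, eq_I_mul_of_re_eq_zero hs, him]
      · intro s hs
        rw [Finset.mem_singleton.1 hs]
        refine ⟨by simp, value_C_mul_eq_one hθ h0 hsin, ?_⟩
        rwa [logDeriv_C, zero_add, ← hderiv]
    refine ⟨⟨hnec, fun h => ?_⟩, hsuf⟩
    obtain ⟨f, -, h⟩ := hsuf h
    exact ⟨f, h⟩
  · intro n g ωp hg θ hθ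
    have hω := hg.pos
    have h0 : freqResp g ωp ≠ 0 := norm_pos_iff.1
      ((norm_nonneg _).trans_lt (hg.lt_peak 0 hω.ne (by linarith)))
    have hmax : ∀ ω, ‖freqResp g ω‖ ≤ ‖freqResp g ωp‖ := fun ω => by
      by_cases h : ω = ωp
      · rw [h]
      by_cases h' : ω = -ωp
      · rw [h', freqResp_neg, RCLike.norm_conj]
      · exact (hg.lt_peak ω h h').le
    set s₀ : ℂ := Complex.I * (ωp : ℂ) with hs₀
    have hre₀ : s₀.re = 0 := by simp [hs₀]
    have him₀ : s₀.im = ωp := by simp [hs₀]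
    have hgp : ¬ IsPole g s₀ := hg.isRLInf.1 ωp
    have hderiv := deriv_phase hθ hgp h0
    have hne : s₀ ≠ conj s₀ := fun h => by
      have := congrArg Complex.im h
      rw [Complex.conj_im, him₀] at this
      linarith
    have hpeak : ∀ s : ℂ, s.re = 0 → ¬ ‖freqResp g s.im‖ < ‖freqResp g ωp‖ →
        s ∈ ({s₀, conj s₀} : Finset ℂ) := fun s hs hn => by
      rw [Finset.mem_insert, Finset.mem_singleton]
      by_contra! hcon
      refine hn (hg.lt_peak _ (fun h => hcon.1 ?_) (fun h => hcon.2 ?_))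
      · apply Complex.ext
        · rw [hs, hre₀]
        · rw [h, him₀]
      · apply Complex.ext
        · rw [hs, Complex.conj_re, hre₀]
        · rw [h, Complex.conj_im, him₀]
    have hnec : (∃ f : RatFunc ℝ, IsRHInf f ∧ hInfNorm f = 1 / ‖freqResp g ωp‖ ∧
        MarginallyStabilizes f g) → (n = 2 ∧ |Real.sin (θ ωp) / ωp| < deriv θ ωp) := by
      rintro ⟨f, hf, hnorm, hfg⟩
      obtain ⟨Z, hcard, hZ, hone⟩ :=
        exists_crossings_of_marginallyStabilizes hg.toClassG hmax h0 hf hnorm hfg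
      have hsub : Z ⊆ {s₀, conj s₀} := fun s hs =>
        hpeak s (hZ s hs).1 ((hZ s hs).2.2.1 ▸ lt_irrefl _)
      have hle := Finset.card_le_card hsub
      rw [Finset.card_pair hne] at hle
      have hn : n ≠ 0 := by
        rw [← hg.numUnstablePoles_eq]
        exact numUnstablePoles_ne_zero hg.unstable
      -- a single unstable pole would move along the real axis and could not reach `±jωp`
      have hn1 : n ≠ 1 := fun h => by
        obtain ⟨s, hs⟩ := Finset.card_ne_zero.1 (by rwa [hcard] : Z.card ≠ 0)
        have hs0 := hone (hcard.trans h) s hs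
        have := (hZ s hs).2.2.1
        rw [hs0, Complex.zero_im] at this
        exact (hg.lt_peak 0 hω.ne (by linarith)).ne this
      -- so both peaks are crossed, and the crossing at `jωp` bounds the phase rate of `g`
      have hZeq : Z = {s₀, conj s₀} :=
        Finset.eq_of_subset_of_card_le hsub (by rw [Finset.card_pair hne]; omega)
      obtain ⟨-, h1, -, hpos⟩ := hZ s₀ (by rw [hZeq]; simp)
      refine ⟨by omega, ?_⟩
      have := (abs_sin_le_of_value_mul_eq_one hθ h0 hf hnorm h1).1
      rw [abs_of_pos hω, ← div_le_iff₀ hω] at this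
      rw [Complex.add_re] at hpos
      rw [hderiv, abs_div, abs_of_pos hω]
      linarith
    have hcross : ∀ f : RatFunc ℝ, n = 2 → IsRHInf f → hInfNorm f = 1 / ‖freqResp g ωp‖ →
        value f s₀ * value g s₀ = 1 →
        0 < (deriv (value f) s₀ / value f s₀ + deriv (value g) s₀ / value g s₀).re →
        MarginallyStabilizes f g := by
      rintro f hn hf hnorm h1 hpos
      refine marginallyStabilizes_of_crossings hg.toClassG hmax h0 hf hnorm
        (Z := {s₀, conj s₀}) (by rw [Finset.card_pair hne, hn]) (fun s hs hsZ => ?_) ?_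
      · by_contra hlt
        exact hsZ (hpeak s hs hlt)
      · intro s hs
        rw [Finset.mem_insert, Finset.mem_singleton] at hs
        rcases hs with rfl | rfl
        · exact ⟨hre₀, h1, hpos⟩
        · exact crossing_conj (not_isPole_of_isRHInf hf hre₀.ge) hgp ⟨hre₀, h1, hpos⟩
    have hsuf : (n = 2 ∧ |Real.sin (θ ωp) / ωp| < deriv θ ωp) → ∃ f : RatFunc ℝ,
        ((Real.sin (θ ωp) = 0 ∧ ∃ c : ℝ, f = RatFunc.C c) ∨
          (Real.sin (θ ωp) ≠ 0 ∧ IsFirstOrderAllPass f)) ∧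
        IsRHInf f ∧ hInfNorm f = 1 / ‖freqResp g ωp‖ ∧ MarginallyStabilizes f g := by
      rintro ⟨hn, hpos⟩
      by_cases hsin : Real.sin (θ ωp) = 0
      · have hnorm := hInfNorm_C_cos_div (norm_nonneg (freqResp g ωp)) hsin
        refine ⟨RatFunc.C (Real.cos (θ ωp) / ‖freqResp g ωp‖), Or.inl ⟨hsin, _, rfl⟩,
          isRHInf_C _, hnorm, hcross _ hn (isRHInf_C _) hnorm (value_C_mul_eq_one hθ h0 hsin) ?_⟩
        rw [logDeriv_C, zero_add, ← hderiv]
        simpa [hsin] using hpos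
      · obtain ⟨σ, a, hσ, ha, hrate, hreal, himag⟩ := exists_allPass_parameters hω hsin
        have hc : 0 < ‖freqResp g ωp‖ := norm_pos_iff.2 h0
        have hk : σ / ‖freqResp g ωp‖ ≠ 0 :=
          div_ne_zero (fun h => by simp [h] at hσ) hc.ne'
        have hf := isRHInf_allPass (σ / ‖freqResp g ωp‖) ha
        have hnorm : hInfNorm (RatFunc.C (σ / ‖freqResp g ωp‖) *
            ((RatFunc.C a - RatFunc.X) / (RatFunc.C a + RatFunc.X))) = 1 / ‖freqResp g ωp‖ := by
          rw [hInfNorm_allPass _ ha, abs_div, hσ, abs_of_pos hc]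
        refine ⟨_, Or.inr ⟨hsin, _, a, hk, ha, rfl⟩, hf, hnorm, hcross _ hn hf hnorm ?_ ?_⟩
        · have h2 : value g s₀ =
              ‖freqResp g ωp‖ * (Real.cos (θ ωp) + Real.sin (θ ωp) * Complex.I) :=
            freqResp_eq_of_isPhaseNear hθ
          have hp := add_ne_zero_of_re_nonneg ha hre₀.ge
          have hc' : (‖freqResp g ωp‖ : ℂ) ≠ 0 := by exact_mod_cast hc.ne'
          have hreal' : (σ : ℂ) * (a * Real.cos (θ ωp) + ωp * Real.sin (θ ωp)) = a := by
            exact_mod_cast hreal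
          have himag' : (σ : ℂ) * (a * Real.sin (θ ωp) - ωp * Real.cos (θ ωp)) = ωp := by
            exact_mod_cast himag
          rw [value_allPass _ hp, h2, Complex.ofReal_div, div_mul_eq_mul_div, div_eq_one_iff_eq hp]
          have e : (σ : ℂ) / ‖freqResp g ωp‖ * (a - s₀) *
              (‖freqResp g ωp‖ * (Real.cos (θ ωp) + Real.sin (θ ωp) * Complex.I)) =
              σ * (a - s₀) * (Real.cos (θ ωp) + Real.sin (θ ωp) * Complex.I) := by
            field_simp
          rw [e, hs₀]
          linear_combination hreal' + Complex.I * himag' -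
            σ * ωp * Real.sin (θ ωp) * Complex.I_sq
        · rw [logDeriv_allPass hk ha, hrate, Complex.add_re, Complex.ofReal_re, ← hderiv]
          rw [abs_div, abs_of_pos hω] at hpos
          linarith
    refine ⟨⟨hnec, fun h => ?_⟩, hsuf⟩
    obtain ⟨f, -, h⟩ := hsuf h
    exact ⟨f, h⟩
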